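/- Let $f(x)=\frac1n\sum_{i=1}^n f_i(x)$ on $\mathbb{R}^d$, where each $f_i$ is convex and differentiable with $L$-Lipschitz gradient ($L>0$) and $f$ is $\mu$-strongly convex ($\mu>0$); let $x^*$ be the minimizer of $f$ and $\kappa=L/\mu$. Let $S_i=\{v : [f_i'(x)]_v\neq 0 \text{ for some } x\}$ be the support of $f_i'$, let $p_v=\frac1n|\{i: v\in S_i\}|$, let $D_i$ be the diagonal matrix with entries $1/p_v$ for $v\in S_i$ and $0$ otherwise, and let $\Delta=\max_v p_v$. *Algorithm (ASAGA).* Cores share a vector $x$, initialized to $x_0$, and a table $(\alpha_i)_{i=1}^n$ of vectors, initialized to $(\alpha_i^0)_{i=1}^n$ with each $\alpha_i^0$ supported on $S_i$. In every iteration a core (1) reads all coordinates of $x$ and of all $\alpha_j$ one by one, at arbitrary times (inconsistent read), (2) then samples an index $i$, and (3) then writes, one by one for $v\in S_i$ and at arbitrary times, the atomic update $[x]_v\leftarrow[x]_v-\gamma[g(\hat x,\hat\alpha,i)]_v$ and the assignment $[\alpha_i]_v\leftarrow[f_i'(\hat x)]_v$, where $(\hat x,\hat\alpha)$ are the values read and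 $$g(\hat x,\hat\alpha,i)=f_i'(\hat x)-\hat\alpha_i+D_i\Big(\tfrac1n\sum_{k=1}^n\hat\alpha_k\Big).$$ Iterations are labeled "after read": $\hat x_t,\hat\alpha^t,i_t$ ($t=0,1,2,\dots$) belong to the iteration whose read is the $(t+1)$-st to be completed. Each $i_t$ is uniform on $\{1,\dots,n\}$ and independent of the past, i.e. of $(\hat x_s,\hat\alpha^s)_{s\le t}$ and $(i_s)_{s<t}$ jointly. Overlaps are bounded by an integer $\tau\ge0$: for all $t$ and all $r\ge t+\tau+1$, the iterations $r$ and $t$ are never processed at the same time, an iteration being processed from the start of its read to the end of its writes. *Theorem.* Suppose $\tau<n/10$ and let $$a^*(\tau)=\frac{1}{32\,(1+\tau\sqrt\Delta)\,\xi(\kappa,\Delta,\tau)},\qquad \xi(\kappa,\Delta,\tau)=\sqrt{1+\frac1{8\kappa}\min\Big\{\frac1{\sqrt\Delta},\tau\Big\}}.$$ For any step size $\gamma=a/L$ with $0<a\le a^*(\tau)$, the inconsistent-read iterates satisfy, for all $t\ge0$, $$\mathbb{E} f(\hat x_t)-f(x^*)\le(1-\rho)^t\,\tilde C_0,\qquad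 \rho=\frac15\min\Big\{\frac1n,\frac a\kappa\Big\},$$ $$\tilde C_0=\frac{21n}{\gamma}\Big(\|x_0-x^*\|^2+\gamma\,\frac{n}{2L}\cdot\frac1n\sum_{i=1}^n\|\alpha_i^0-f_i'(x^*)\|^2\Big),$$ where in particular the expectation is finite. -/

import Mathlib

open MeasureTheory ProbabilityTheory

namespace Asaga

noncomputable section

/-- Parameter vectors: `ℝ^d` with the Euclidean norm. -/
abbrev Vec (d : ℕ) : Type := EuclideanSpace ℝ (Fin d)

/-! ### The finite-sum problem and its sparsity -/

/-- The objective `f(x) = (1/n) ∑ i, f_i(x)`. -/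
def objective {n d : ℕ} (f : Fin n → Vec d → ℝ) (x : Vec d) : ℝ :=
  (1 / (n : ℝ)) * ∑ i, f i x

/-- The support of a factor: the coordinates in which its gradient can be nonzero. -/
def support {d : ℕ} (h : Vec d → ℝ) : Set (Fin d) :=
  {v | ∃ x : Vec d, gradient h x v ≠ 0}

/-- The number `|{i : v ∈ S_i}|` of factors whose support contains the coordinate `v`. -/
def degree {n d : ℕ} (f : Fin n → Vec d → ℝ) (v : Fin d) : ℕ :=
  Set.ncard {i : Fin n | v ∈ support (f i)}

/-- `Δ_r = max_v |{i : v ∈ S_i}|`. -/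
def maxDegree {n d : ℕ} (f : Fin n → Vec d → ℝ) : ℕ :=
  Finset.univ.sup (degree f)

/-- The sparsity `Δ = Δ_r / n`. -/
def sparsity {n d : ℕ} (f : Fin n → Vec d → ℝ) : ℝ :=
  (maxDegree f : ℝ) / n

/-- `p_v`, the probability that `v ∈ S_i` when `i` is uniform on the `n` factors. -/
def coordProb {n d : ℕ} (f : Fin n → Vec d → ℝ) (v : Fin d) : ℝ :=
  (degree f v : ℝ) / n

open Classical in
/-- The diagonal matrix `D_i = P_{S_i} D`, with `D = diag(1 / p_v)`, applied to a vector. -/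
def reweight {n d : ℕ} (f : Fin n → Vec d → ℝ) (i : Fin n) (z : Vec d) : Vec d :=
  WithLp.toLp 2 fun v => if v ∈ support (f i) then z v / coordProb f v else 0

/-- The update direction `g(x, α, i) = f_i'(x) - α_i + D_i ((1/n) ∑ k, α_k)`. -/
def direction {n d : ℕ} (f : Fin n → Vec d → ℝ) (x : Vec d) (α : Fin n → Vec d) (i : Fin n) :
    Vec d :=
  gradient (f i) x - α i + reweight f i ((1 / (n : ℝ)) • ∑ k, α k)

/-! ### Asynchronous executions -/

/-- The timing of one asynchronous execution, on any number of cores. The iterations are labelled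
"after read": iteration `t` is the one whose read of the shared memory (the vector `x` and the
table `α`) is the `(t+1)`-st to be completed. Within an iteration, the coordinates are read one by
one, at arbitrary times and in arbitrary order (inconsistent reads); after the read is completed
the coordinates of the update are written one by one, again at arbitrary times.
An iteration writes only the coordinates in the support of the factor that it samples; the write
times of the other coordinates have no meaning and are never used. -/
structure Schedule (n d : ℕ) where
  /-- when iteration `t` starts to read -/
  start : ℕ → ℝ
  /-- when iteration `t` has completed its read -/
  readEnd : ℕ → ℝ
  /-- when iteration `t` has written its whole update -/
  finish : ℕ → ℝ
  /-- when iteration `t` reads `[x]_v` -/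
  readX : ℕ → Fin d → ℝ
  /-- when iteration `t` reads `[α_j]_v` -/
  readA : ℕ → Fin n → Fin d → ℝ
  /-- when iteration `t` performs its atomic update of `[x]_v` -/
  writeX : ℕ → Fin d → ℝ
  /-- when iteration `t` overwrites `[α_i]_v`, for the index `i` that it has sampled -/
  writeA : ℕ → Fin d → ℝ
  readX_mem : ∀ t v, readX t v ∈ Set.Icc (start t) (readEnd t)
  readA_mem : ∀ t j v, readA t j v ∈ Set.Icc (start t) (readEnd t)
  writeX_mem : ∀ t v, writeX t v ∈ Set.Icc (readEnd t) (finish t)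
  writeA_mem : ∀ t v, writeA t v ∈ Set.Icc (readEnd t) (finish t)
  start_le_readEnd : ∀ t, start t ≤ readEnd t
  readEnd_le_finish : ∀ t, readEnd t ≤ finish t
  readEnd_strictMono : StrictMono readEnd

namespace Schedule

variable {n d : ℕ}

/-- Two iterations overlap if at some time both are being processed, an iteration being processed
from the start of its read to the end of its writes. -/
def Overlap (S : Schedule n d) (r t : ℕ) : Prop :=
  (Set.Icc (S.start r) (S.finish r) ∩ Set.Icc (S.start t) (S.finish t)).Nonempty

/-- Bounded overlaps: iterations `r ≥ t + τ + 1` never overlap with iteration `t`. -/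
def BoundedOverlap (S : Schedule n d) (τ : ℕ) : Prop :=
  ∀ t r : ℕ, t + τ + 1 ≤ r → ¬ S.Overlap r t

/-- Iteration `u` writes the table entry `[α_j]_v` before iteration `t` reads it. -/
def WritesBefore (S : Schedule n d) (f : Fin n → Vec d → ℝ) (i : ℕ → Fin n)
    (u t : ℕ) (j : Fin n) (v : Fin d) : Prop :=
  i u = j ∧ v ∈ support (f j) ∧ S.writeA u v < S.readA t j v

open Classical in
/-- The iteration that made the last write to `[α_j]_v` before iteration `t` reads this entry;
`none` if the entry still has its initial value. -/
def lastWriter (S : Schedule n d) (f : Fin n → Vec d → ℝ) (i : ℕ → Fin n)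
    (t : ℕ) (j : Fin n) (v : Fin d) : Option (Fin t) :=
  if h : ∃ u : Fin t, S.WritesBefore f i u t j v ∧
      ∀ w : Fin t, S.WritesBefore f i w t j v → S.writeA w v ≤ S.writeA u v
  then some h.choose else none

end Schedule

open Classical in
/-- The values `(x̂_t, α̂^t)` read by iteration `t` of Asaga with step size `γ`, initial memory
`(x0, α0)`, sampled indices `i 0, i 1, …` and timing `S`.

The coordinate `[x̂_t]_v` is the initial value plus all the atomic updates `-γ [g(x̂_u, α̂^u, i_u)]_v`
that were made to it before it was read. The entry `[α̂^t_j]_v` is the value `[f_j'(x̂_u)]_v` of the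
last write to it before it was read, or its initial value. Only iterations `u < t` can have
written before the read of iteration `t` is completed, since an iteration writes after its read. -/
def reads {n d : ℕ} (f : Fin n → Vec d → ℝ) (γ : ℝ) (x0 : Vec d) (α0 : Fin n → Vec d)
    (i : ℕ → Fin n) (S : Schedule n d) (t : ℕ) : Vec d × (Fin n → Vec d) :=
  (WithLp.toLp 2 fun v => x0 v + ∑ u : Fin t,
      if v ∈ support (f (i u)) ∧ S.writeX u v < S.readX t v then
        -γ * direction f (reads f γ x0 α0 i S u).1 (reads f γ x0 α0 i S u).2 (i u) v
      else 0,
   fun j => WithLp.toLp 2 fun v =>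
      match S.lastWriter f i t j v with
      | none => α0 j v
      | some u => gradient (f j) (reads f γ x0 α0 i S u).1 v)
termination_by t
decreasing_by all_goals exact u.isLt

/-- Iteration `t` samples `i t` uniformly, after its read is completed: `i t` is uniform on the `n`
indices and independent of everything that has been read by the iterations `0, …, t` and sampled
by the iterations `0, …, t - 1`. The timing of the execution may depend on the samples otherwise. -/
structure FreshSampling {n d : ℕ} {Ω : Type*} [MeasurableSpace Ω] (P : Measure Ω)
    (i : ℕ → Ω → Fin n) (R : ℕ → Ω → Vec d × (Fin n → Vec d)) : Prop where
  measurable_sample : ∀ t, Measurable (i t)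
  measurable_read : ∀ t, Measurable (R t)
  uniform : ∀ t j, P {ω | i t ω = j} = (n : ENNReal)⁻¹
  indep : ∀ t, IndepFun (i t)
    (fun ω => ((fun s : Fin t => i s ω), (fun s : Fin (t + 1) => R s ω))) P

/-! ### The constants -/

/-- `ξ(κ, Δ, τ) = √(1 + (1 / (8 κ)) min {1 / √Δ, τ})`. -/
def xi (κ Δ τ : ℝ) : ℝ :=
  Real.sqrt (1 + 1 / (8 * κ) * min (1 / Real.sqrt Δ) τ)

/-- `a*(τ) = 1 / (32 (1 + τ √Δ) ξ(κ, Δ, τ))`. -/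
def aStar (κ Δ τ : ℝ) : ℝ :=
  1 / (32 * (1 + τ * Real.sqrt Δ) * xi κ Δ τ)

/-- `ρ(a) = (1/5) min {1/n, a/κ}`. -/
def rate (n : ℕ) (κ a : ℝ) : ℝ :=
  1 / 5 * min (1 / (n : ℝ)) (a * (1 / κ))

/-- `C̃_0 = (21 n / γ) (‖x_0 - x*‖² + γ (n / (2 L)) E ‖α_i^0 - f_i'(x*)‖²)`, where the expectation
is over `i` uniform on the `n` indices. -/
def initConst {n d : ℕ} (f : Fin n → Vec d → ℝ) (L γ : ℝ) (x0 : Vec d) (α0 : Fin n → Vec d)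
    (xstar : Vec d) : ℝ :=
  21 * n / γ * (‖x0 - xstar‖ ^ 2 +
    γ * (n / (2 * L)) * ((1 / (n : ℝ)) * ∑ i, ‖α0 i - gradient (f i) xstar‖ ^ 2))

end

end Asaga

/-!
The argument compares the values `x̂_t` that are read with the virtual iterates
`x_{t+1} = x_t - γ g(x̂_t, α̂^t, i_t)`, which apply whole updates in the order of the completed reads.
Pathwise, two facts about the timing suffice. An iteration `u` with `u + τ + 1 ≤ t` has written
everything before iteration `t` starts to read, so `x̂_t - x_t` consists of coordinates of the last `τ`
updates (`abs_reads_sub_virtualIterate_le`). Also, an entry of `α̂^t_j` written by iteration `u` has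
survived every iteration of the window `[u + τ + 1, t - τ)`, none of which sampled `j`
(`norm_reads_snd_sub_sq_le`). The timing may depend on the samples in any way: it enters through these
two bounds only, and their right-hand sides do not mention it except through what was read.

In expectation, freshness of `i_t` is used four times.
* The update is unbiased (`integral_inner_update`), so strong convexity makes `E ‖x_t - x*‖²`
  contract and gain `2 γ (E f(x̂_t) - f(x*))`.
* Its second moment is controlled by the present suboptimality and by the mean squared error of the
  table (`integral_norm_update_sq_le`): the reweighted mean of the table acts as a control variate.
* Each later iteration misses the index `j` with probability `1 - 1/n`, so the table forgets old
  gradients geometrically (`integral_norm_table_sub_sq_le`).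
* A later update is supported on a random factor, so two different updates overlap only by a factor
  `√Δ` (`integral_overlap_le_of_ne`). This bounds all the terms with `x̂_t - x_t`.

What remains are two coupled delayed recursions for real sequences. Summing them with the weights
`(1 - ρ)^{-(t+1)}` turns each delay kernel into its weighted mass: `τ (1 - ρ)^{-τ}` for the overlaps and
`O(n)` for the memory of the table, since `5 ρ ≤ 1/n` and `10 τ < n`. The step size condition then lets
the term `2 γ ∑ (1 - ρ)^{-(t+1)} (E f(x̂_t) - f(x*))` absorb the error terms, with room to spare in the
constant (`suboptimality_le_of_recursion`). The factor `ξ` in the step size serves to bound the one term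
of third order in the step, `γ μ E ‖x̂_t - x_t‖²` (`aStar_bounds`).

If `Δ = 0`, then `1 / √Δ` is not meaningful, but all gradients vanish and the objective is constant.
-/

namespace Asaga

/-! ### Smooth and strongly convex functions -/

section Convexity

variable {E : Type*} [NormedAddCommGroup E] [InnerProductSpace ℝ E] [CompleteSpace E]

theorem hasDerivAt_comp_line {f : E → ℝ} (hf : Differentiable ℝ f) (x δ : E) (s : ℝ) :
    HasDerivAt (fun s : ℝ => f (x + s • δ)) (inner ℝ (gradient f (x + s • δ)) δ) s := by
  have h1 : HasDerivAt (fun s : ℝ => x + s • δ) δ s := by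
    simpa using ((hasDerivAt_id s).smul_const δ).const_add x
  have h2 := (hf (x + s • δ)).hasFDerivAt.comp_hasDerivAt s h1
  rwa [← inner_gradient_left] at h2

theorem nonneg_of_hasDerivAt_of_nonneg_right {h : ℝ → ℝ} {h' : ℝ} (hd : HasDerivAt h h' 0)
    (h0 : h 0 = 0) (hpos : ∀ s ∈ Set.Ioo (0 : ℝ) 1, 0 ≤ h s) : 0 ≤ h' := by
  have ht := (hasDerivWithinAt_iff_tendsto_slope' (s := Set.Ioi (0 : ℝ)) (by simp)).1
    hd.hasDerivWithinAt
  refine ge_of_tendsto ht ?_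
  filter_upwards [Ioo_mem_nhdsGT (zero_lt_one (α := ℝ))] with s hs
  rw [slope_def_field, h0, sub_zero, sub_zero]
  exact div_nonneg (hpos s hs) hs.1.le

/-- First-order lower bound for a differentiable strongly convex function; `m = 0` is the convex
case. -/
theorem _root_.StrongConvexOn.gradient_le {f : E → ℝ} {m : ℝ}
    (hs : StrongConvexOn Set.univ m f) (hf : Differentiable ℝ f) (x y : E) :
    f x + inner ℝ (gradient f x) (y - x) + m / 2 * ‖y - x‖ ^ 2 ≤ f y := by
  have hline := hasDerivAt_comp_line hf x (y - x) 0
  have hd : HasDerivAt (fun s : ℝ => f x + s * (f y - f x) - s * (1 - s) * (m / 2 * ‖y - x‖ ^ 2)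
      - f (x + s • (y - x)))
      ((f y - f x) - m / 2 * ‖y - x‖ ^ 2 - inner ℝ (gradient f x) (y - x)) 0 := by
    have hq : HasDerivAt (fun s : ℝ => s * (1 - s)) 1 0 := by
      simpa using (hasDerivAt_id' (0 : ℝ)).fun_mul ((hasDerivAt_id' (0 : ℝ)).const_sub 1)
    have hl : HasDerivAt (fun s : ℝ => f x + s * (f y - f x)) (f y - f x) 0 := by
      simpa using ((hasDerivAt_id (0 : ℝ)).mul_const (f y - f x)).const_add (f x)
    rw [zero_smul, add_zero] at hline
    simpa only [one_mul] using (hl.fun_sub (hq.mul_const (m / 2 * ‖y - x‖ ^ 2))).fun_sub hline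
  have := nonneg_of_hasDerivAt_of_nonneg_right hd (by simp) fun s hs' => by
    have h := hs.2 (Set.mem_univ x) (Set.mem_univ y) (sub_nonneg.2 hs'.2.le) hs'.1.le
      (sub_add_cancel 1 s)
    have e : (1 - s) • x + s • y = x + s • (y - x) := by module
    rw [e, norm_sub_rev x y, smul_eq_mul, smul_eq_mul] at h
    linarith
  linarith

/-- The quadratic upper bound for a function with Lipschitz gradient. -/
theorem le_add_inner_add_of_lipschitz_gradient {f : E → ℝ} {L : ℝ} (hf : Differentiable ℝ f)
    (hL : ∀ x y, ‖gradient f x - gradient f y‖ ≤ L * ‖x - y‖) (x y : E) :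
    f y ≤ f x + inner ℝ (gradient f x) (y - x) + L / 2 * ‖y - x‖ ^ 2 := by
  set δ := y - x with hδ
  let h : ℝ → ℝ := fun s => s * inner ℝ (gradient f x) δ + s ^ 2 * (L / 2 * ‖δ‖ ^ 2)
      - f (x + s • δ)
  have hd : ∀ s, HasDerivAt h (inner ℝ (gradient f x) δ + 2 * s * (L / 2 * ‖δ‖ ^ 2)
      - inner ℝ (gradient f (x + s • δ)) δ) s := fun s => by
    have h1 : HasDerivAt (fun s : ℝ => s * inner ℝ (gradient f x) δ)
        (inner ℝ (gradient f x) δ) s := by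
      simpa using (hasDerivAt_id s).mul_const (inner ℝ (gradient f x) δ)
    have h2 : HasDerivAt (fun s : ℝ => s ^ 2) (2 * s) s := by simpa using hasDerivAt_pow 2 s
    exact (h1.add (h2.mul_const (L / 2 * ‖δ‖ ^ 2))).sub (hasDerivAt_comp_line hf x δ s)
  have hmono : MonotoneOn h (Set.Ici 0) := by
    refine monotoneOn_of_deriv_nonneg (convex_Ici 0)
      (fun s _ => (hd s).continuousAt.continuousWithinAt)
      (fun s _ => (hd s).differentiableAt.differentiableWithinAt) fun s hs => ?_
    have hs0 : 0 ≤ s := by simpa using interior_subset hs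
    rw [(hd s).deriv]
    have h1 : inner ℝ (gradient f (x + s • δ) - gradient f x) δ ≤ L * (s * ‖δ‖) * ‖δ‖ := by
      refine (real_inner_le_norm _ _).trans ?_
      gcongr
      refine (hL _ _).trans_eq ?_
      rw [add_sub_cancel_left, norm_smul, Real.norm_of_nonneg hs0]
    rw [inner_sub_left] at h1
    nlinarith
  have := hmono (Set.mem_Ici.2 le_rfl) (Set.mem_Ici.2 zero_le_one) zero_le_one
  simp only [h, zero_smul, add_zero, one_smul, hδ, add_sub_cancel] at this
  rw [hδ]
  linarith

/-- The gradient of a convex smooth function is controlled by its Bregman divergence. -/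
theorem _root_.ConvexOn.norm_gradient_sub_sq_le {f : E → ℝ} {L : ℝ} (hL0 : 0 < L)
    (hc : ConvexOn ℝ Set.univ f) (hf : Differentiable ℝ f)
    (hL : ∀ x y, ‖gradient f x - gradient f y‖ ≤ L * ‖x - y‖) (x y : E) :
    ‖gradient f x - gradient f y‖ ^ 2
      ≤ 2 * L * (f x - f y - inner ℝ (gradient f y) (x - y)) := by
  set δ := gradient f x - gradient f y with hδ
  -- a gradient step of length `1 / L` for `f - ⟪∇f(y), ·⟫`, which is minimal at `y`
  have h1 := (strongConvexOn_zero.2 hc).gradient_le hf y (x - (1 / L) • δ)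
  have h2 := le_add_inner_add_of_lipschitz_gradient hf hL x (x - (1 / L) • δ)
  have e1 : x - (1 / L) • δ - y = (x - y) - (1 / L) • δ := by abel
  have e2 : x - (1 / L) • δ - x = -((1 / L) • δ) := by abel
  rw [e1, inner_sub_right, inner_smul_right] at h1
  rw [e2, inner_neg_right, inner_smul_right, norm_neg, norm_smul, Real.norm_of_nonneg
    (by positivity)] at h2
  have h3 : inner ℝ (gradient f x) δ - inner ℝ (gradient f y) δ = ‖δ‖ ^ 2 := by
    rw [← inner_sub_left, ← hδ, real_inner_self_eq_norm_sq]
  have h4 : L / 2 * (1 / L * ‖δ‖) ^ 2 = 1 / L * ‖δ‖ ^ 2 / 2 := by field_simp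
  have h5 : 1 / L * ‖δ‖ ^ 2 ≤ 2 * (f x - f y - inner ℝ (gradient f y) (x - y)) := by
    rw [← h3] at h4 ⊢
    nlinarith
  have h6 := mul_le_mul_of_nonneg_left h5 hL0.le
  have e : L * (1 / L * ‖δ‖ ^ 2) = ‖δ‖ ^ 2 := by field_simp
  linarith

end Convexity

section Objective

variable {n d : ℕ} {f : Fin n → Vec d → ℝ}

theorem differentiable_objective (hdiff : ∀ i, Differentiable ℝ (f i)) :
    Differentiable ℝ (objective f) := by
  unfold objective
  fun_prop

theorem gradient_objective (hdiff : ∀ i, Differentiable ℝ (f i)) (x : Vec d) :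
    gradient (objective f) x = (1 / (n : ℝ)) • ∑ i, gradient (f i) x := by
  apply (InnerProductSpace.toDual ℝ (Vec d)).injective
  rw [toDual_gradient, map_smul, map_sum]
  simp_rw [toDual_gradient]
  have : HasFDerivAt (objective f) ((1 / (n : ℝ)) • ∑ i, fderiv ℝ (f i) x) x :=
    (HasFDerivAt.fun_sum fun i _ => (hdiff i x).hasFDerivAt).const_mul _
  rw [this.fderiv]

theorem gradient_objective_eq_zero {xstar : Vec d}
    (hxstar : ∀ x, objective f xstar ≤ objective f x) : gradient (objective f) xstar = 0 := by
  apply (InnerProductSpace.toDual ℝ (Vec d)).injective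
  rw [toDual_gradient, map_zero]
  exact IsLocalMin.fderiv_eq_zero (Filter.Eventually.of_forall hxstar)

theorem sum_gradient_minimizer (hn : 0 < n) (hdiff : ∀ i, Differentiable ℝ (f i)) {xstar : Vec d}
    (hxstar : ∀ x, objective f xstar ≤ objective f x) : ∑ i, gradient (f i) xstar = 0 := by
  have h := gradient_objective_eq_zero hxstar
  rw [gradient_objective hdiff, smul_eq_zero] at h
  refine h.resolve_left ?_
  positivity

/-- The mean squared variation of the factor gradients from the minimizer is at most `2 L` times the
suboptimality: the linear terms cancel on average. -/
theorem mean_norm_gradient_sub_sq_le (hn : 0 < n) {L : ℝ} (hL : 0 < L)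
    (hconvex : ∀ i, ConvexOn ℝ Set.univ (f i)) (hdiff : ∀ i, Differentiable ℝ (f i))
    (hsmooth : ∀ i x y, ‖gradient (f i) x - gradient (f i) y‖ ≤ L * ‖x - y‖) {xstar : Vec d}
    (hxstar : ∀ x, objective f xstar ≤ objective f x) (x : Vec d) :
    (1 / (n : ℝ)) * ∑ i, ‖gradient (f i) x - gradient (f i) xstar‖ ^ 2
      ≤ 2 * L * (objective f x - objective f xstar) := by
  have h1 : ∑ i, ‖gradient (f i) x - gradient (f i) xstar‖ ^ 2
      ≤ ∑ i, 2 * L * (f i x - f i xstar - inner ℝ (gradient (f i) xstar) (x - xstar)) :=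
    Finset.sum_le_sum fun i _ =>
      (hconvex i).norm_gradient_sub_sq_le hL (hdiff i) (hsmooth i) x xstar
  rw [← Finset.mul_sum, Finset.sum_sub_distrib, Finset.sum_sub_distrib, ← sum_inner,
    sum_gradient_minimizer hn hdiff hxstar, inner_zero_left, sub_zero] at h1
  have h2 := mul_le_mul_of_nonneg_left h1 (by positivity : (0 : ℝ) ≤ 1 / n)
  unfold objective
  linarith

theorem continuous_gradient_of_lipschitz {E : Type*} [NormedAddCommGroup E]
    [InnerProductSpace ℝ E] [CompleteSpace E] {h : E → ℝ} {L : ℝ}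
    (hL : ∀ x y, ‖gradient h x - gradient h y‖ ≤ L * ‖x - y‖) : Continuous (gradient h) :=
  (LipschitzWith.of_dist_le' (K := L) fun x y => by
    simpa only [dist_eq_norm] using hL x y).continuous

end Objective

/-! ### Delayed recursions -/

section Recursion

/-- A causal convolution with kernel `k` is bounded on geometrically weighted sums by the weighted
mass `K` of the kernel. As `u < t`, the argument `t - 1 - u` is not truncated. -/
theorem sum_pow_mul_convolution_le {r K : ℝ} (hr : 0 ≤ r) {k b : ℕ → ℝ} (hb : ∀ u, 0 ≤ b u)
    (hK : ∀ M, ∑ m ∈ Finset.range M, r ^ (m + 1) * k m ≤ K) (N : ℕ) :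
    ∑ t ∈ Finset.range N, r ^ (t + 1) * ∑ u ∈ Finset.range t, k (t - 1 - u) * b u
      ≤ K * ∑ u ∈ Finset.range N, r ^ (u + 1) * b u := by
  simp_rw [Finset.mul_sum]
  rw [Finset.sum_comm' (t' := Finset.range N) (s' := fun u => Finset.Ico (u + 1) N)
    (by intro x y; simp only [Finset.mem_range, Finset.mem_Ico]; omega)]
  refine Finset.sum_le_sum fun u _ => ?_
  have h : ∑ t ∈ Finset.Ico (u + 1) N, r ^ (t + 1) * (k (t - 1 - u) * b u)
      = (r ^ (u + 1) * b u) * ∑ m ∈ Finset.range (N - (u + 1)), r ^ (m + 1) * k m := by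
    rw [Finset.sum_Ico_eq_sum_range, Finset.mul_sum]
    refine Finset.sum_congr rfl fun m _ => ?_
    have e : u + 1 + m - 1 - u = m := by omega
    rw [e]
    ring
  rw [h, mul_comm K]
  exact mul_le_mul_of_nonneg_left (hK _) (mul_nonneg (pow_nonneg hr _) (hb u))

theorem sum_pow_window_le {r : ℝ} (hr : 1 ≤ r) (τ M : ℕ) :
    ∑ m ∈ Finset.range M, r ^ (m + 1) * (if m < τ then 1 else 0) ≤ τ * r ^ τ := by
  simp_rw [mul_ite, mul_one, mul_zero]
  rw [← Finset.sum_filter]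
  calc ∑ m ∈ Finset.range M with m < τ, r ^ (m + 1)
      ≤ ∑ m ∈ Finset.range τ, r ^ (m + 1) :=
        Finset.sum_le_sum_of_subset_of_nonneg (by intro m; simp) fun _ _ _ => by positivity
    _ ≤ ∑ _m ∈ Finset.range τ, r ^ τ := Finset.sum_le_sum fun m hm =>
        pow_le_pow_right₀ hr (Finset.mem_range.1 hm)
    _ = τ * r ^ τ := by simp

/-- Geometric decay with ratio `q` that only starts after a delay `s`, weighted by a growth `r`. -/
theorem sum_pow_delayed_geometric_le {r q : ℝ} (hr : 1 ≤ r) (hq : 0 ≤ q) (hrq : r * q < 1)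
    (s M : ℕ) :
    ∑ m ∈ Finset.range M, r ^ (m + 1) * q ^ (m - s) ≤ r ^ s * (s + r / (1 - r * q)) := by
  have hr0 : 0 ≤ r := zero_le_one.trans hr
  calc ∑ m ∈ Finset.range M, r ^ (m + 1) * q ^ (m - s)
      ≤ ∑ m ∈ Finset.range (s + M), r ^ (m + 1) * q ^ (m - s) :=
        Finset.sum_le_sum_of_subset_of_nonneg (Finset.range_mono (by omega))
          fun _ _ _ => by positivity
    _ = ∑ m ∈ Finset.range s, r ^ (m + 1) * q ^ (m - s)
        + r ^ (s + 1) * ∑ m ∈ Finset.range M, (r * q) ^ m := by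
        rw [Finset.sum_range_add, Finset.mul_sum]
        congr 1
        refine Finset.sum_congr rfl fun m _ => ?_
        rw [Nat.add_sub_cancel_left, mul_pow]
        ring
    _ ≤ ∑ _m ∈ Finset.range s, r ^ s + r ^ (s + 1) * (1 - r * q)⁻¹ := by
        gcongr with m hm
        · have hm' := Finset.mem_range.1 hm
          rw [Nat.sub_eq_zero_of_le hm'.le, pow_zero, mul_one]
          exact pow_le_pow_right₀ hr hm'
        · rw [← tsum_geometric_of_lt_one (by positivity) hrq]
          exact (summable_geometric_of_lt_one (by positivity) hrq).sum_le_tsum _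
            fun _ _ => by positivity
    _ = r ^ s * (s + r / (1 - r * q)) := by
        rw [Finset.sum_const, Finset.card_range, nsmul_eq_mul]
        ring

/-- Unrolling of `a (t + 1) ≤ (1 - ρ) a t + B t - c e t` with the weights `(1 - ρ)⁻ᵗ`. -/
theorem sum_pow_mul_le_of_contraction {r c : ℝ} (hr : 0 < r) {a B e : ℕ → ℝ} (ha : ∀ t, 0 ≤ a t)
    (h : ∀ t, a (t + 1) ≤ r⁻¹ * a t + B t - c * e t) (N : ℕ) :
    c * ∑ t ∈ Finset.range N, r ^ (t + 1) * e t
      ≤ a 0 + ∑ t ∈ Finset.range N, r ^ (t + 1) * B t := by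
  suffices r ^ N * a N + c * ∑ t ∈ Finset.range N, r ^ (t + 1) * e t
      ≤ a 0 + ∑ t ∈ Finset.range N, r ^ (t + 1) * B t by
    have := mul_nonneg (pow_nonneg hr.le N) (ha N)
    linarith
  induction N with
  | zero => simp
  | succ N ih =>
    rw [Finset.sum_range_succ, Finset.sum_range_succ]
    have h1 := mul_le_mul_of_nonneg_left (h N) (pow_nonneg hr.le (N + 1))
    have e1 : r ^ (N + 1) * (r⁻¹ * a N + B N - c * e N)
        = r ^ N * a N + r ^ (N + 1) * B N - c * (r ^ (N + 1) * e N) := by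
      field_simp
      ring
    linarith

/-- `(1 - ρ)⁻ˢ ≤ 1 / (1 - s ρ)`, from Bernoulli's inequality. -/
theorem inv_one_sub_pow_le {ρ c : ℝ} (hρ : ρ < 1) (s : ℕ) (hs : s * ρ ≤ c) (hc : c < 1) :
    ((1 - ρ)⁻¹) ^ s ≤ (1 - c)⁻¹ := by
  rw [inv_pow]
  have h := one_add_mul_le_pow (a := -ρ) (by linarith) s
  apply inv_anti₀ (by linarith)
  rw [← sub_eq_add_neg] at h
  linarith

theorem aStar_bounds {κ Δ a : ℝ} {τ : ℝ} (hκ : 0 < κ) (hΔ : 0 < Δ) (hτ : 0 ≤ τ) (ha : 0 < a)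
    (h : a ≤ aStar κ Δ τ) :
    a * (1 + τ * √Δ) ≤ 1 / 32 ∧ a ^ 2 * (1 + τ * √Δ) * τ / κ ≤ 1 / 128 := by
  have hs : 0 < √Δ := Real.sqrt_pos.2 hΔ
  set s := √Δ
  set C := 1 + τ * s with hC
  have hC1 : 1 ≤ C := by have := mul_nonneg hτ hs.le; linarith
  set m := min (1 / s) τ with hm
  have hm0 : 0 ≤ m := le_min (by positivity) hτ
  have hmC : τ ≤ m * C := by
    rcases min_cases (1 / s) τ with ⟨h1, -⟩ | ⟨h1, -⟩
    · rw [hm, h1, hC]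
      have : 1 / s * (1 + τ * s) = 1 / s + τ := by field_simp
      rw [this]
      have := one_div_pos.2 hs
      linarith
    · rw [hm, h1]
      nlinarith
  have hξsq : xi κ Δ τ ^ 2 = 1 + m / κ / 8 := by
    unfold xi
    rw [Real.sq_sqrt (by positivity), ← hm]
    field_simp
  have hξ1 : 1 ≤ xi κ Δ τ := by
    unfold xi
    rw [Real.one_le_sqrt, ← hm]
    have : 0 ≤ 1 / (8 * κ) * m := by positivity
    linarith
  set ξ := xi κ Δ τ
  have h1 : a * C * ξ ≤ 1 / 32 := by
    have h2 : a ≤ 1 / (32 * C * ξ) := h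
    rw [le_div_iff₀ (by positivity)] at h2
    linarith
  have haC : 0 < a * C := by positivity
  refine ⟨by nlinarith, ?_⟩
  have h3 : (a * C) ^ 2 * (1 + m / κ / 8) ≤ 1 / 1024 := by
    rw [← hξsq, ← mul_pow]
    have : 0 ≤ a * C * ξ := by positivity
    nlinarith
  have h4 : a ^ 2 * C * τ / κ ≤ (a * C) ^ 2 * (m / κ) := by
    calc a ^ 2 * C * τ / κ ≤ a ^ 2 * C * (m * C) / κ := by gcongr
      _ = (a * C) ^ 2 * (m / κ) := by ring
  have : 0 ≤ (a * C) ^ 2 := sq_nonneg _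
  nlinarith

theorem rate_bounds {n : ℕ} (hn : 0 < n) {κ a : ℝ} (hκ : 0 < κ) (ha : 0 < a) :
    0 < rate n κ a ∧ rate n κ a * n ≤ 1 / 5 ∧ rate n κ a ≤ a / κ / 2 := by
  have hn' : (0 : ℝ) < n := by exact_mod_cast hn
  unfold rate
  refine ⟨by positivity, ?_, ?_⟩
  · have h := mul_le_mul_of_nonneg_right (min_le_left (1 / (n : ℝ)) (a * (1 / κ))) hn'.le
    rw [one_div_mul_cancel hn'.ne'] at h
    linarith
  · have h := min_le_right (1 / (n : ℝ)) (a * (1 / κ))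
    have : 0 < a / κ := by positivity
    rw [mul_one_div] at h ⊢
    linarith

/-- Weighted sums of the gradient moments: the table remembers old gradients for a geometric time
of mean `n`, after a delay of at most `2 τ`. -/
theorem sum_pow_mul_le_of_memory {n τ : ℕ} (hn : 0 < n) (hτ : (τ : ℝ) < n / 10) {L V ρ : ℝ}
    (hL : 0 < L) (hV : 0 ≤ V) (hρ0 : 0 < ρ) (hρn : ρ * n ≤ 1 / 5) {G e : ℕ → ℝ}
    (he : ∀ t, 0 ≤ e t)
    (hgrad : ∀ t, G t ≤ 4 * L * e t
      + 4 * L / n * ∑ u ∈ Finset.range t, (1 - 1 / (n : ℝ)) ^ (t - τ - (u + τ + 1)) * e u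
      + 2 * (1 - 1 / (n : ℝ)) ^ (t - τ) * V) (N : ℕ) :
    ∑ t ∈ Finset.range N, ((1 - ρ)⁻¹) ^ (t + 1) * G t
      ≤ 4 * L * (63 / 25) * ∑ t ∈ Finset.range N, ((1 - ρ)⁻¹) ^ (t + 1) * e t
        + 14 / 5 * n * V := by
  have hn' : (0 : ℝ) < n := by exact_mod_cast hn
  have hn1 : (1 : ℝ) ≤ n := by exact_mod_cast hn
  set q := 1 - 1 / (n : ℝ) with hq
  have hρ1 : ρ < 1 := by nlinarith
  set r := (1 - ρ)⁻¹ with hr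
  have hr1 : 1 ≤ r := (one_le_inv₀ (by linarith)).2 (by linarith)
  have hr0 : 0 < r := by linarith
  have hq0 : 0 ≤ q := by
    rw [hq, sub_nonneg, div_le_one hn']
    exact hn1
  have hρn' : ρ ≤ 1 / n / 5 := by
    rw [div_div, le_div_iff₀ (by positivity)]
    linarith
  have hninv : (0 : ℝ) < 1 / n := by positivity
  have hqρ : q < 1 - ρ := by rw [hq]; linarith
  have hrq : r * q < 1 := by
    rw [hr, inv_mul_lt_one₀ (by linarith)]
    exact hqρ
  -- the weighted mass of the geometric tail is at most `5 n / 4`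
  have htail : r / (1 - r * q) ≤ 5 / 4 * n := by
    have e1 : r / (1 - r * q) = 1 / (1 - ρ - q) := by
      have h1 : 1 - ρ ≠ 0 := by linarith
      have h2 : 1 - ρ - q ≠ 0 := by linarith
      rw [hr]
      field_simp
    rw [e1, div_le_iff₀ (by linarith), hq]
    have : (n : ℝ) * (1 / n) = 1 := by field_simp
    nlinarith
  have hrτ : r ^ τ ≤ 50 / 49 := by
    refine (inv_one_sub_pow_le (c := 1 / 50) hρ1 τ ?_ (by norm_num)).trans (by norm_num)
    nlinarith
  have hr2τ : r ^ (2 * τ) ≤ 25 / 24 := by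
    refine (inv_one_sub_pow_le (c := 1 / 25) hρ1 (2 * τ) ?_ (by norm_num)).trans (by norm_num)
    push_cast
    nlinarith
  set E := ∑ t ∈ Finset.range N, r ^ (t + 1) * e t with hE
  have hE0 : 0 ≤ E := Finset.sum_nonneg fun u _ => mul_nonneg (by positivity) (he u)
  have h1 : ∑ t ∈ Finset.range N, r ^ (t + 1) * G t ≤ ∑ t ∈ Finset.range N, r ^ (t + 1) * (4 * L * e t
    + 4 * L / n * ∑ u ∈ Finset.range t, q ^ (t - 1 - u - 2 * τ) * e u
    + 2 * q ^ (t - τ) * V) := by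
    refine Finset.sum_le_sum fun s _ => ?_
    refine mul_le_mul_of_nonneg_left ((hgrad s).trans_eq ?_) (by positivity)
    congr 3
    refine Finset.sum_congr rfl fun u _ => ?_
    congr 2
    omega
  have h2 := sum_pow_mul_convolution_le hr0.le (k := fun m => q ^ (m - 2 * τ)) he
    (sum_pow_delayed_geometric_le hr1 hq0 hrq (2 * τ)) N
  have h3 := sum_pow_delayed_geometric_le hr1 hq0 hrq τ N
  have e1 : ∑ t ∈ Finset.range N, r ^ (t + 1) * (4 * L * e t
    + 4 * L / n * ∑ u ∈ Finset.range t, q ^ (t - 1 - u - 2 * τ) * e u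
    + 2 * q ^ (t - τ) * V) = 4 * L * E
      + 4 * L / n * ∑ t ∈ Finset.range N, r ^ (t + 1) *
          ∑ u ∈ Finset.range t, q ^ (t - 1 - u - 2 * τ) * e u
      + 2 * V * ∑ t ∈ Finset.range N, r ^ (t + 1) * q ^ (t - τ) := by
    rw [hE, Finset.mul_sum, Finset.mul_sum, Finset.mul_sum, ← Finset.sum_add_distrib,
      ← Finset.sum_add_distrib]
    refine Finset.sum_congr rfl fun s _ => ?_
    ring
  rw [e1] at h1
  have h4 : r ^ (2 * τ) * ((2 * τ : ℕ) + r / (1 - r * q)) ≤ 38 / 25 * n := by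
    calc r ^ (2 * τ) * ((2 * τ : ℕ) + r / (1 - r * q))
        ≤ 25 / 24 * (n / 5 + 5 / 4 * n) := by
          gcongr
          push_cast
          linarith
      _ ≤ 38 / 25 * n := by linarith
  have h5 : r ^ τ * (τ + r / (1 - r * q)) ≤ 7 / 5 * n := by
    calc r ^ τ * (τ + r / (1 - r * q)) ≤ 50 / 49 * (n / 10 + 5 / 4 * n) := by gcongr
      _ ≤ 7 / 5 * n := by linarith
  have h6 := mul_le_mul_of_nonneg_left (h2.trans (mul_le_mul_of_nonneg_right h4 hE0))
    (by positivity : 0 ≤ 4 * L / n)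
  have h7 := mul_le_mul_of_nonneg_left (h3.trans h5) (by positivity : 0 ≤ 2 * V)
  have e2 : 4 * L / n * (38 / 25 * n * E) = 4 * L * (38 / 25) * E := by field_simp
  rw [e2] at h6
  linarith

/-- The rate extracted from the two coupled delayed recursions: `D t` stands for
`E ‖x_t - x*‖²`, `G t` for `E ‖g_t‖²`, `e t` for the expected suboptimality of what is read, and
`V` for the mean squared error of the initial table. -/
theorem suboptimality_le_of_recursion {n τ : ℕ} (hn : 0 < n) (hτ : (τ : ℝ) < n / 10)
    {L μ a Δ V : ℝ} (hL : 0 < L) (hμ : 0 < μ) (hΔ : 0 < Δ) (ha : 0 < a)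
    (haS : a ≤ aStar (L / μ) Δ τ) (hV : 0 ≤ V)
    {D G e : ℕ → ℝ} (hD : ∀ t, 0 ≤ D t) (hG : ∀ t, 0 ≤ G t) (he : ∀ t, 0 ≤ e t)
    (hrec : ∀ t, D (t + 1) ≤ (1 - a / L * μ / 2) * D t
      + (a / L) ^ 2 * ((1 + τ * √Δ) * G t
        + (√Δ + a / L * μ * (1 + τ * √Δ)) * ∑ u ∈ Finset.Ico (t - τ) t, G u)
      - 2 * (a / L) * e t)
    (hgrad : ∀ t, G t ≤ 4 * L * e t
      + 4 * L / n * ∑ u ∈ Finset.range t, (1 - 1 / (n : ℝ)) ^ (t - τ - (u + τ + 1)) * e u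
      + 2 * (1 - 1 / (n : ℝ)) ^ (t - τ) * V) (t : ℕ) :
    e t ≤ (1 - rate n (L / μ) a) ^ t *
      (21 * n / (a / L) * (D 0 + a / L * (n / (2 * L)) * V)) := by
  have hn' : (0 : ℝ) < n := by exact_mod_cast hn
  have hn1 : (1 : ℝ) ≤ n := by exact_mod_cast hn
  have hκ : 0 < L / μ := by positivity
  obtain ⟨hρ0, hρn, hρa⟩ := rate_bounds hn hκ ha
  obtain ⟨hb1, hb2⟩ := aStar_bounds hκ hΔ (Nat.cast_nonneg τ) ha haS
  set ρ := rate n (L / μ) a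
  set γ := a / L with hγ
  have hγ0 : 0 < γ := by positivity
  have hγL : γ * L = a := by rw [hγ]; field_simp
  set C := 1 + (τ : ℝ) * √Δ with hC
  have hρ1 : ρ < 1 := by nlinarith
  set r := (1 - ρ)⁻¹ with hr
  have hr1 : 1 ≤ r := (one_le_inv₀ (by linarith)).2 (by linarith)
  have hr0 : 0 < r := by linarith
  have hrτ : r ^ τ ≤ 50 / 49 := by
    refine (inv_one_sub_pow_le (c := 1 / 50) hρ1 τ ?_ (by norm_num)).trans (by norm_num)
    nlinarith
  set E := ∑ t ∈ Finset.range (t + 1), r ^ (t + 1) * e t with hE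
  set GG := ∑ t ∈ Finset.range (t + 1), r ^ (t + 1) * G t with hGG
  have hE0 : 0 ≤ E := Finset.sum_nonneg fun u _ => mul_nonneg (by positivity) (he u)
  have hGG0 : 0 ≤ GG := Finset.sum_nonneg fun u _ => mul_nonneg (by positivity) (hG u)
  have hGGle : GG ≤ 4 * L * (63 / 25) * E + 14 / 5 * n * V :=
    sum_pow_mul_le_of_memory hn hτ hL hV hρ0 hρn he hgrad (t + 1)
  -- the weighted sum of the delayed terms
  have hwin : ∑ t ∈ Finset.range (t + 1), r ^ (t + 1) * ∑ u ∈ Finset.Ico (t - τ) t, G u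
      ≤ τ * (50 / 49) * GG := by
    have h2 := sum_pow_mul_convolution_le hr0.le (k := fun m => if m < τ then 1 else 0) hG
      (sum_pow_window_le hr1 τ) (t + 1)
    have e1 : ∀ s, ∑ u ∈ Finset.range s, (if s - 1 - u < τ then (1 : ℝ) else 0) * G u
        = ∑ u ∈ Finset.Ico (s - τ) s, G u := fun s => by
      simp_rw [ite_mul, one_mul, zero_mul]
      rw [← Finset.sum_filter]
      refine Finset.sum_congr ?_ fun _ _ => rfl
      ext u
      simp only [Finset.mem_filter, Finset.mem_range, Finset.mem_Ico]
      omega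
    simp_rw [e1] at h2
    refine h2.trans (mul_le_mul_of_nonneg_right ?_ hGG0)
    gcongr
  have hmain := sum_pow_mul_le_of_contraction hr0 (c := 2 * γ) (a := D) (e := e)
    (B := fun t => γ ^ 2 * (C * G t + (√Δ + γ * μ * C) * ∑ u ∈ Finset.Ico (t - τ) t, G u))
    hD (fun s => by
      refine (hrec s).trans ?_
      have : (1 - γ * μ / 2) * D s ≤ r⁻¹ * D s := by
        refine mul_le_mul_of_nonneg_right ?_ (hD s)
        rw [hr, inv_inv]
        have : a / (L / μ) / 2 = γ * μ / 2 := by rw [hγ]; field_simp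
        linarith
      linarith) (t + 1)
  have e3 : ∑ t ∈ Finset.range (t + 1), r ^ (t + 1) *
      (γ ^ 2 * (C * G t + (√Δ + γ * μ * C) * ∑ u ∈ Finset.Ico (t - τ) t, G u))
      = γ ^ 2 * (C * GG + (√Δ + γ * μ * C) *
        ∑ t ∈ Finset.range (t + 1), r ^ (t + 1) * ∑ u ∈ Finset.Ico (t - τ) t, G u) := by
    rw [hGG, Finset.mul_sum, Finset.mul_sum, ← Finset.sum_add_distrib, Finset.mul_sum]
    refine Finset.sum_congr rfl fun s _ => ?_
    ring
  rw [e3] at hmain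
  have hC0 : 0 < C := by positivity
  have hmain2 : 2 * γ * E ≤ D 0 + γ ^ 2 * (C * GG + (√Δ + γ * μ * C) * (τ * (50 / 49) * GG)) := by
    refine hmain.trans ?_
    gcongr
  have hcoef : γ * L * (C + (√Δ + γ * μ * C) * (τ * (50 / 49))) ≤ 1 / 14 := by
    rw [hγL]
    have e4 : a * (C + (√Δ + γ * μ * C) * (τ * (50 / 49)))
        = a * C + 50 / 49 * (a * (τ * √Δ) + a ^ 2 * C * τ / (L / μ)) := by
      rw [hγ]
      field_simp
    rw [e4]
    have h1 : a * (τ * √Δ) ≤ a * C := mul_le_mul_of_nonneg_left (by rw [hC]; linarith) ha.le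
    linarith
  set K := C + (√Δ + γ * μ * C) * (τ * (50 / 49)) with hK
  have hK0 : 0 ≤ K := by positivity
  have h8 : γ ^ 2 * (C * GG + (√Δ + γ * μ * C) * (τ * (50 / 49) * GG)) = γ ^ 2 * K * GG := by
    rw [hK]; ring
  rw [h8] at hmain2
  have h9 : γ ^ 2 * K * GG ≤ γ * (1 / 14) * (4 * (63 / 25) * E + 14 / 5 * (n / L * V)) := by
    calc γ ^ 2 * K * GG ≤ γ ^ 2 * K * (4 * L * (63 / 25) * E + 14 / 5 * n * V) := by gcongr
      _ = γ * (γ * L * K) * (4 * (63 / 25) * E + 14 / 5 * (n / L * V)) := by field_simp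
      _ ≤ _ := by gcongr
  have hlast : r ^ (t + 1) * e t ≤ E :=
    Finset.single_le_sum (f := fun t => r ^ (t + 1) * e t)
      (fun u _ => mul_nonneg (by positivity) (he u)) (Finset.self_mem_range_succ t)
  have hW : a / L * (n / (2 * L)) * V = γ * (n / L * V) / 2 := by rw [hγ]; field_simp
  have hnLV : 0 ≤ γ * (n / L * V) := by positivity
  have h10 : γ * E ≤ D 0 + a / L * (n / (2 * L)) * V := by
    rw [hW]
    have : 0 ≤ γ * E := by positivity
    linarith
  set W := D 0 + a / L * (n / (2 * L)) * V with hWdef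
  have hW0 : 0 ≤ W := (by positivity : 0 ≤ γ * E).trans h10
  have h11 : e t ≤ (1 - ρ) ^ (t + 1) * (W / γ) := by
    have h12 : E ≤ W / γ := by rw [le_div_iff₀ hγ0]; linarith
    have h13 := mul_le_mul_of_nonneg_left (hlast.trans h12)
      (pow_nonneg (by linarith : (0 : ℝ) ≤ 1 - ρ) (t + 1))
    rwa [← mul_assoc, ← mul_pow, hr, mul_inv_cancel₀ (by linarith), one_pow, one_mul] at h13
  refine h11.trans ?_
  have h14 : 0 ≤ W / γ := by positivity
  have e5 : 21 * n / γ * W = 21 * n * (W / γ) := by ring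
  rw [e5]
  exact mul_le_mul (pow_le_pow_of_le_one (by linarith) (by linarith) (Nat.le_succ t))
    (le_mul_of_one_le_left h14 (by linarith)) h14 (pow_nonneg (by linarith) _)

end Recursion

/-! ### The sparse variance-reduced direction -/

section Direction

variable {n d : ℕ} {f : Fin n → Vec d → ℝ}

theorem gradient_apply_eq_zero {h : Vec d → ℝ} {v : Fin d} (hv : v ∉ support h) (x : Vec d) :
    gradient h x v = 0 := by
  by_contra hne
  exact hv ⟨x, hne⟩

open Classical in
theorem card_filter_support (v : Fin d) :
    (Finset.univ.filter fun i : Fin n => v ∈ support (f i)).card = degree f v := by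
  rw [degree, Set.ncard_eq_toFinset_card']
  congr 1
  ext i
  simp

theorem coordProb_le_sparsity (v : Fin d) : coordProb f v ≤ sparsity f := by
  unfold coordProb sparsity maxDegree
  gcongr
  exact_mod_cast Finset.le_sup (f := degree f) (Finset.mem_univ v)

open Classical in
theorem reweight_apply (hn : 0 < n) (i : Fin n) (α : Fin n → Vec d) (v : Fin d) :
    reweight f i ((1 / (n : ℝ)) • ∑ k, α k) v
      = if v ∈ support (f i) then (∑ k, α k v) / degree f v else 0 := by
  have hn' : (n : ℝ) ≠ 0 := by positivity
  simp only [reweight, coordProb, PiLp.smul_apply, WithLp.ofLp_sum, Finset.sum_apply, smul_eq_mul]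
  congr 1
  rcases eq_or_ne (degree f v : ℝ) 0 with h | h
  · simp [h]
  · field_simp

theorem direction_apply_eq_zero {x : Vec d} {α : Fin n → Vec d}
    (hα : ∀ j, ∀ v ∉ support (f j), α j v = 0) {i : Fin n} {v : Fin d}
    (hv : v ∉ support (f i)) : direction f x α i v = 0 := by
  simp [direction, reweight, gradient_apply_eq_zero hv, hα i v hv, hv]

theorem sum_eq_zero_of_degree_eq_zero {α : Fin n → Vec d}
    (hα : ∀ j, ∀ v ∉ support (f j), α j v = 0) {v : Fin d} (h : degree f v = 0) :
    ∑ j, α j v = 0 := by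
  refine Finset.sum_eq_zero fun j _ => hα j v fun hj => ?_
  rw [degree, Set.ncard_eq_zero] at h
  exact (Set.eq_empty_iff_forall_notMem.1 h j) hj

theorem sum_reweight (hn : 0 < n) {α : Fin n → Vec d}
    (hα : ∀ j, ∀ v ∉ support (f j), α j v = 0) :
    ∑ j, reweight f j ((1 / (n : ℝ)) • ∑ k, α k) = ∑ j, α j := by
  classical
  ext v
  simp only [WithLp.ofLp_sum, Finset.sum_apply]
  simp_rw [reweight_apply hn]
  rw [← Finset.sum_filter, Finset.sum_const, card_filter_support, nsmul_eq_mul]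
  rcases eq_or_ne (degree f v) 0 with h | h
  · rw [sum_eq_zero_of_degree_eq_zero hα h]
    simp
  · field_simp

/-- The direction is unbiased for a uniform index: the reweighting compensates the sparsity. -/
theorem mean_inner_direction (hn : 0 < n) (hdiff : ∀ i, Differentiable ℝ (f i)) {α : Fin n → Vec d}
    (hα : ∀ j, ∀ v ∉ support (f j), α j v = 0) (x y : Vec d) :
    (1 / (n : ℝ)) * ∑ j, inner ℝ y (direction f x α j) = inner ℝ y (gradient (objective f) x) := by
  have h : ∑ j, direction f x α j = ∑ j, gradient (f j) x := by
    simp only [direction]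
    rw [Finset.sum_add_distrib, sum_reweight hn hα, Finset.sum_sub_distrib, sub_add_cancel]
  rw [← inner_sum, h, gradient_objective hdiff, inner_smul_right]

/-- Subtracting the reweighted mean does not increase the mean square: coordinatewise it is the
variance over the factors that contain the coordinate. -/
theorem sum_norm_sub_reweight_sq_le (hn : 0 < n) {α c : Fin n → Vec d}
    (hα : ∀ j, ∀ v ∉ support (f j), α j v = 0) (hc : ∀ j, ∀ v ∉ support (f j), c j v = 0)
    (hc0 : ∑ j, c j = 0) :
    ∑ j, ‖α j - c j - reweight f j ((1 / (n : ℝ)) • ∑ k, α k)‖ ^ 2 ≤ ∑ j, ‖α j - c j‖ ^ 2 := by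
  classical
  simp_rw [EuclideanSpace.real_norm_sq_eq, PiLp.sub_apply, reweight_apply hn]
  rw [Finset.sum_comm, Finset.sum_comm (f := fun j v => (α j v - c j v) ^ 2)]
  refine Finset.sum_le_sum fun v _ => ?_
  set s := ∑ k, α k v with hs
  set k := (degree f v : ℝ) with hk
  have e1 : ∀ j, (α j v - c j v - (if v ∈ support (f j) then s / k else 0)) ^ 2
      = (α j v - c j v) ^ 2 - 2 * (s / k) * (α j v - c j v)
        + (if v ∈ support (f j) then (s / k) ^ 2 else 0) := fun j => by
    split_ifs with h
    · ring
    · rw [hα j v h, hc j v h]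
      ring
  have e2 : ∑ j, (α j v - c j v) = s := by
    have h0 := congrArg (fun z : Vec d => z v) hc0
    simp only [WithLp.ofLp_sum, Finset.sum_apply, PiLp.zero_apply] at h0
    rw [Finset.sum_sub_distrib, h0, sub_zero]
  simp_rw [e1]
  rw [Finset.sum_add_distrib, Finset.sum_sub_distrib, ← Finset.mul_sum, e2, ← Finset.sum_filter,
    Finset.sum_const, card_filter_support, nsmul_eq_mul, ← hk]
  have e3 : k * (s / k) ^ 2 = s / k * s := by
    rcases eq_or_ne k 0 with h | h
    · simp [h]
    · field_simp
  have e4 : 0 ≤ s / k * s := by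
    have : s / k * s = s ^ 2 / k := by ring
    rw [this]
    positivity
  rw [e3]
  linarith

theorem sum_norm_direction_sq_le (hn : 0 < n) {α c : Fin n → Vec d}
    (hα : ∀ j, ∀ v ∉ support (f j), α j v = 0) (hc : ∀ j, ∀ v ∉ support (f j), c j v = 0)
    (hc0 : ∑ j, c j = 0) (x : Vec d) :
    ∑ j, ‖direction f x α j‖ ^ 2
      ≤ 2 * ∑ j, ‖gradient (f j) x - c j‖ ^ 2 + 2 * ∑ j, ‖α j - c j‖ ^ 2 := by
  have h : ∀ j, ‖direction f x α j‖ ^ 2 ≤ 2 * ‖gradient (f j) x - c j‖ ^ 2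
      + 2 * ‖α j - c j - reweight f j ((1 / (n : ℝ)) • ∑ k, α k)‖ ^ 2 := fun j => by
    have e : direction f x α j = (gradient (f j) x - c j)
        - (α j - c j - reweight f j ((1 / (n : ℝ)) • ∑ k, α k)) := by
      rw [direction]
      abel
    rw [e]
    set p := gradient (f j) x - c j
    set q := α j - c j - reweight f j ((1 / (n : ℝ)) • ∑ k, α k)
    have := parallelogram_law_with_norm ℝ p q
    nlinarith [sq_nonneg ‖p + q‖]
  refine (Finset.sum_le_sum fun j _ => h j).trans ?_
  rw [Finset.sum_add_distrib, ← Finset.mul_sum, ← Finset.mul_sum]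
  have := sum_norm_sub_reweight_sq_le hn hα hc hc0
  linarith

theorem continuous_direction (hcont : ∀ i, Continuous (gradient (f i))) (j : Fin n) :
    Continuous fun p : Vec d × (Fin n → Vec d) => direction f p.1 p.2 j := by
  classical
  have h : Continuous fun p : Vec d × (Fin n → Vec d) =>
      reweight f j ((1 / (n : ℝ)) • ∑ k, p.2 k) := by
    unfold reweight
    refine (PiLp.continuous_toLp 2 _).comp (continuous_pi fun v => ?_)
    split_ifs
    · refine Continuous.div_const ?_ _
      fun_prop
    · exact continuous_const
  have := hcont j
  unfold direction
  fun_prop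

end Direction

/-! ### Pathwise properties of an execution -/

section Execution

variable {n d : ℕ}

namespace Schedule

variable {S : Schedule n d} {f : Fin n → Vec d → ℝ} {i : ℕ → Fin n} {t : ℕ} {j : Fin n}
  {v : Fin d}

theorem BoundedOverlap.finish_lt_start {τ : ℕ} (hS : S.BoundedOverlap τ) {u t : ℕ}
    (h : u + τ + 1 ≤ t) : S.finish u < S.start t := by
  by_contra! hle
  refine hS u t h ⟨max (S.start t) (S.start u), ⟨le_max_left _ _, ?_⟩, ⟨le_max_right _ _, ?_⟩⟩
  · have h1 := S.start_le_readEnd t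
    have h2 := S.readEnd_le_finish t
    have h3 := S.start_le_readEnd u
    have h4 := S.readEnd_strictMono (show u < t by omega)
    exact max_le (by linarith) (by linarith)
  · exact max_le hle ((S.start_le_readEnd u).trans (S.readEnd_le_finish u))

theorem lastWriter_eq_some {u : Fin t} (h : S.lastWriter f i t j v = some u) :
    S.WritesBefore f i u t j v ∧
      ∀ w : Fin t, S.WritesBefore f i w t j v → S.writeA w v ≤ S.writeA u v := by
  unfold lastWriter at h
  split_ifs at h with hex
  rw [Option.some.injEq] at h
  rw [← h]
  exact hex.choose_spec

theorem lastWriter_eq_none (h : S.lastWriter f i t j v = none) (w : Fin t) :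
    ¬ S.WritesBefore f i w t j v := by
  classical
  intro hw
  unfold lastWriter at h
  split_ifs at h with hex
  obtain ⟨u, hu, hmax⟩ := Finset.exists_max_image
    (Finset.univ.filter fun w : Fin t => S.WritesBefore f i w t j v) (fun w => S.writeA w v)
    ⟨w, by simpa using hw⟩
  exact hex ⟨u, by simpa using hu, fun w hw => hmax w (by simpa using hw)⟩

end Schedule

variable {f : Fin n → Vec d → ℝ} {γ : ℝ} {x0 : Vec d} {α0 : Fin n → Vec d} {i : ℕ → Fin n}
  {S : Schedule n d}

open Classical in
theorem reads_fst_apply (t : ℕ) (v : Fin d) :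
    (reads f γ x0 α0 i S t).1 v = x0 v + ∑ u ∈ Finset.range t,
      if v ∈ support (f (i u)) ∧ S.writeX u v < S.readX t v then
        -γ * direction f (reads f γ x0 α0 i S u).1 (reads f γ x0 α0 i S u).2 (i u) v
      else 0 := by
  rw [reads, ← Fin.sum_univ_eq_sum_range fun u =>
    if v ∈ support (f (i u)) ∧ S.writeX u v < S.readX t v then
        -γ * direction f (reads f γ x0 α0 i S u).1 (reads f γ x0 α0 i S u).2 (i u) v
      else 0]

theorem reads_snd_apply_of_none {t : ℕ} {j : Fin n} {v : Fin d}
    (h : S.lastWriter f i t j v = none) : (reads f γ x0 α0 i S t).2 j v = α0 j v := by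
  rw [reads]
  simp only
  rw [h]

theorem reads_snd_apply_of_some {t : ℕ} {j : Fin n} {v : Fin d} {u : Fin t}
    (h : S.lastWriter f i t j v = some u) :
    (reads f γ x0 α0 i S t).2 j v = gradient (f j) (reads f γ x0 α0 i S u).1 v := by
  rw [reads]
  simp only
  rw [h]

theorem reads_snd_apply_eq_zero (hα0 : ∀ j, ∀ v ∉ support (f j), α0 j v = 0) (t : ℕ) (j : Fin n)
    (v : Fin d) (hv : v ∉ support (f j)) : (reads f γ x0 α0 i S t).2 j v = 0 := by
  cases h : S.lastWriter f i t j v with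
  | none => rw [reads_snd_apply_of_none h, hα0 j v hv]
  | some u => rw [reads_snd_apply_of_some h, gradient_apply_eq_zero hv]

/-- The update `g(x̂_t, α̂^t, i_t)` computed by iteration `t`. -/
noncomputable def update (f : Fin n → Vec d → ℝ) (γ : ℝ) (x0 : Vec d) (α0 : Fin n → Vec d)
    (i : ℕ → Fin n) (S : Schedule n d) (t : ℕ) : Vec d :=
  direction f (reads f γ x0 α0 i S t).1 (reads f γ x0 α0 i S t).2 (i t)

/-- The virtual iterate `x_t`, which contains exactly the whole updates of the iterations before
`t`; it need not be in the shared memory at any time. -/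
noncomputable def virtualIterate (f : Fin n → Vec d → ℝ) (γ : ℝ) (x0 : Vec d)
    (α0 : Fin n → Vec d) (i : ℕ → Fin n) (S : Schedule n d) (t : ℕ) : Vec d :=
  x0 - γ • ∑ u ∈ Finset.range t, update f γ x0 α0 i S u

theorem virtualIterate_succ (t : ℕ) : virtualIterate f γ x0 α0 i S (t + 1)
    = virtualIterate f γ x0 α0 i S t - γ • update f γ x0 α0 i S t := by
  rw [virtualIterate, virtualIterate, Finset.sum_range_succ, smul_add]
  abel

theorem update_apply_eq_zero (hα0 : ∀ j, ∀ v ∉ support (f j), α0 j v = 0) {t : ℕ} {v : Fin d}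
    (hv : v ∉ support (f (i t))) : update f γ x0 α0 i S t v = 0 :=
  direction_apply_eq_zero (reads_snd_apply_eq_zero hα0 t) hv

/-- What is read differs from the virtual iterate only by updates of the last `τ` iterations. -/
theorem abs_reads_sub_virtualIterate_le {τ : ℕ} (hS : S.BoundedOverlap τ) (hγ : 0 ≤ γ)
    (hα0 : ∀ j, ∀ v ∉ support (f j), α0 j v = 0) (t : ℕ) (v : Fin d) :
    |((reads f γ x0 α0 i S t).1 - virtualIterate f γ x0 α0 i S t) v|
      ≤ γ * ∑ u ∈ Finset.Ico (t - τ) t, |update f γ x0 α0 i S u v| := by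
  classical
  have e : ((reads f γ x0 α0 i S t).1 - virtualIterate f γ x0 α0 i S t) v
      = ∑ u ∈ Finset.range t, ((if v ∈ support (f (i u)) ∧ S.writeX u v < S.readX t v then
        -γ * update f γ x0 α0 i S u v else 0) + γ * update f γ x0 α0 i S u v) := by
    rw [PiLp.sub_apply, reads_fst_apply, Finset.sum_add_distrib, ← Finset.mul_sum]
    simp only [virtualIterate, update, PiLp.sub_apply, PiLp.smul_apply, WithLp.ofLp_sum,
      Finset.sum_apply, smul_eq_mul]
    ring
  have hwin : Finset.Ico (t - τ) t = (Finset.range t).filter (t - τ ≤ ·) := by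
    ext u
    simp only [Finset.mem_filter, Finset.mem_range, Finset.mem_Ico]
    omega
  rw [e, hwin, Finset.sum_filter, Finset.mul_sum]
  refine (Finset.abs_sum_le_sum_abs _ _).trans (Finset.sum_le_sum fun u _ => ?_)
  have hg : 0 ≤ γ * |update f γ x0 α0 i S u v| := by positivity
  split_ifs with h1 h2 h2
  · simpa using hg
  · simp
  · rw [zero_add, abs_mul, abs_of_nonneg hγ]
  · have hv : v ∉ support (f (i u)) := fun hv => h1 ⟨hv, by
      have h3 := hS.finish_lt_start (show u + τ + 1 ≤ t by omega)
      exact ((S.writeX_mem u v).2.trans_lt h3).trans_le (S.readX_mem t v).1⟩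
    rw [update_apply_eq_zero hα0 hv]
    simp

/-- Indicator that none of the iterations in `s` samples the index `j`. -/
def avoid (i : ℕ → Fin n) (j : Fin n) (s : Finset ℕ) : ℝ :=
  ∏ w ∈ s, if i w = j then 0 else 1

theorem avoid_nonneg (j : Fin n) (s : Finset ℕ) : 0 ≤ avoid i j s :=
  Finset.prod_nonneg fun w _ => by split_ifs <;> norm_num

theorem avoid_eq_one {j : Fin n} {s : Finset ℕ} (h : ∀ w ∈ s, i w ≠ j) : avoid i j s = 1 :=
  Finset.prod_eq_one fun w hw => if_neg (h w hw)

/-- Each coordinate of a table entry that is read was written by some iteration `u` that sampled the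
index, and then no iteration which is certainly both after `u` and before the read sampled the index;
the same window serves all coordinates, although they may come from different iterations. -/
theorem norm_reads_snd_sub_sq_le {τ : ℕ} (hS : S.BoundedOverlap τ)
    (hα0 : ∀ j, ∀ v ∉ support (f j), α0 j v = 0) (t : ℕ) (j : Fin n) {c : Vec d}
    (hc : ∀ v ∉ support (f j), c v = 0) :
    ‖(reads f γ x0 α0 i S t).2 j - c‖ ^ 2
      ≤ ∑ u ∈ Finset.range t, ‖gradient (f j) (reads f γ x0 α0 i S u).1 - c‖ ^ 2
          * (if i u = j then 1 else 0) * avoid i j (Finset.Ico (u + τ + 1) (t - τ))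
        + ‖α0 j - c‖ ^ 2 * avoid i j (Finset.Ico 0 (t - τ)) := by
  simp_rw [EuclideanSpace.real_norm_sq_eq, Finset.sum_mul]
  rw [Finset.sum_comm, ← Finset.sum_add_distrib]
  refine Finset.sum_le_sum fun v _ => ?_
  have hterm : ∀ u ∈ Finset.range t, 0 ≤ ((gradient (f j) (reads f γ x0 α0 i S u).1 - c) v) ^ 2
      * (if i u = j then 1 else 0) * avoid i j (Finset.Ico (u + τ + 1) (t - τ)) := fun u _ =>
    mul_nonneg (mul_nonneg (sq_nonneg _) (by split_ifs <;> norm_num)) (avoid_nonneg _ _)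
  have hinit : 0 ≤ ((α0 j - c) v) ^ 2 * avoid i j (Finset.Ico 0 (t - τ)) :=
    mul_nonneg (sq_nonneg _) (avoid_nonneg _ _)
  by_cases hv : v ∈ support (f j)
  swap
  · have h0 : ((reads f γ x0 α0 i S t).2 j - c) v = 0 := by
      rw [PiLp.sub_apply, reads_snd_apply_eq_zero hα0 t j v hv, hc v hv, sub_zero]
    rw [h0]
    have := Finset.sum_nonneg hterm
    simp only [ne_eq, OfNat.ofNat_ne_zero, not_false_eq_true, zero_pow]
    linarith
  have hwrites : ∀ w, w + τ + 1 ≤ t → i w = j → S.WritesBefore f i w t j v := fun w hw hij =>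
    ⟨hij, hv, ((S.writeA_mem w v).2.trans_lt (hS.finish_lt_start hw)).trans_le
      (S.readA_mem t j v).1⟩
  cases h : S.lastWriter f i t j v with
  | none =>
    have hone : avoid i j (Finset.Ico 0 (t - τ)) = 1 := avoid_eq_one fun w hw hij => by
      rw [Finset.mem_Ico] at hw
      exact Schedule.lastWriter_eq_none h ⟨w, by omega⟩ (hwrites w (by omega) hij)
    rw [hone, mul_one, PiLp.sub_apply, reads_snd_apply_of_none h, PiLp.sub_apply]
    have := Finset.sum_nonneg hterm
    linarith
  | some u =>
    obtain ⟨hu, hmax⟩ := Schedule.lastWriter_eq_some h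
    have hone : avoid i j (Finset.Ico (u + τ + 1) (t - τ)) = 1 := avoid_eq_one fun w hw hij => by
      rw [Finset.mem_Ico] at hw
      have h1 := hmax ⟨w, by omega⟩ (hwrites w (by omega) hij)
      have h2 := hS.finish_lt_start hw.1
      have h3 := (S.writeA_mem u v).2
      have h4 := (S.writeA_mem w v).1
      have h5 := S.start_le_readEnd w
      simp only at h1
      linarith
    have hle := Finset.single_le_sum hterm (Finset.mem_range.2 u.isLt)
    rw [hone, if_pos hu.1, mul_one, mul_one] at hle
    rw [PiLp.sub_apply, reads_snd_apply_of_some h]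
    rw [PiLp.sub_apply] at hle
    linarith

theorem norm_le_sqrt_of_abs_le {x : Vec d} {B : ℝ} (h : ∀ v, |x v| ≤ B) : ‖x‖ ≤ √(d * B ^ 2) := by
  refine Real.le_sqrt_of_sq_le ?_
  rw [EuclideanSpace.real_norm_sq_eq]
  refine (Finset.sum_le_sum (g := fun _ => B ^ 2) fun v _ => ?_).trans_eq (by simp)
  exact sq_le_sq' (abs_le.1 (h v)).1 (abs_le.1 (h v)).2

theorem exists_norm_direction_le (hcont : ∀ i, Continuous (gradient (f i))) (B : ℝ) :
    ∃ C : ℝ, ∀ (p : Vec d × (Fin n → Vec d)) (j : Fin n), ‖p‖ ≤ B →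
      ‖direction f p.1 p.2 j‖ ≤ C ∧ ‖gradient (f j) p.1‖ ≤ C := by
  have hball := isCompact_closedBall (0 : Vec d × (Fin n → Vec d)) B
  have h1 := fun j => hball.exists_bound_of_continuousOn
    (continuous_direction hcont j).continuousOn
  have h2 := fun j => hball.exists_bound_of_continuousOn
    ((hcont j).comp continuous_fst).continuousOn
  choose C1 hC1 using h1
  choose C2 hC2 using h2
  obtain ⟨M1, hM1⟩ := (Set.finite_range C1).bddAbove
  obtain ⟨M2, hM2⟩ := (Set.finite_range C2).bddAbove
  refine ⟨max M1 M2, fun p j hp => ?_⟩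
  have hp' : p ∈ Metric.closedBall (0 : Vec d × (Fin n → Vec d)) B := mem_closedBall_zero_iff.2 hp
  exact ⟨((hC1 j p hp').trans (hM1 ⟨j, rfl⟩)).trans (le_max_left _ _),
    ((hC2 j p hp').trans (hM2 ⟨j, rfl⟩)).trans (le_max_right _ _)⟩

/-- Whatever the samples and the timing, the values read by iteration `t` stay in a fixed ball; so
all expectations below exist. -/
theorem exists_norm_reads_le (hcont : ∀ i, Continuous (gradient (f i))) (γ : ℝ) (x0 : Vec d)
    (α0 : Fin n → Vec d) (t : ℕ) :
    ∃ B : ℝ, ∀ (i : ℕ → Fin n) (S : Schedule n d), ‖reads f γ x0 α0 i S t‖ ≤ B := by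
  classical
  induction t using Nat.strong_induction_on with
  | _ t ih =>
    have h : ∀ u : ℕ, ∃ C : ℝ, u < t → ∀ (i : ℕ → Fin n) (S : Schedule n d) (j : Fin n),
        ‖direction f (reads f γ x0 α0 i S u).1 (reads f γ x0 α0 i S u).2 j‖ ≤ C ∧
        ‖gradient (f j) (reads f γ x0 α0 i S u).1‖ ≤ C := fun u => by
      by_cases hu : u < t
      · obtain ⟨B, hB⟩ := ih u hu
        obtain ⟨C, hC⟩ := exists_norm_direction_le hcont B
        exact ⟨C, fun _ i S j => hC _ j (hB i S)⟩
      · exact ⟨0, fun h => absurd h hu⟩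
    choose C hC using h
    set M := ‖x0‖ + ‖α0‖ + ∑ u ∈ Finset.range t, (|γ| + 1) * |C u| with hM
    refine ⟨√(d * M ^ 2), fun i S => ?_⟩
    have hterm : ∀ u ∈ Finset.range t, 0 ≤ (|γ| + 1) * |C u| := fun u _ => by positivity
    have hx0 := norm_nonneg x0
    have hα0 := norm_nonneg α0
    refine max_le (norm_le_sqrt_of_abs_le fun v => ?_)
      ((pi_norm_le_iff_of_nonneg (Real.sqrt_nonneg _)).2 fun j => norm_le_sqrt_of_abs_le fun v => ?_)
    · rw [reads_fst_apply]
      refine (abs_add_le _ _).trans ?_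
      have h1 : |x0 v| ≤ ‖x0‖ := PiLp.norm_apply_le x0 v
      have h2 := (Finset.abs_sum_le_sum_abs (fun u =>
        if v ∈ support (f (i u)) ∧ S.writeX u v < S.readX t v then
        -γ * direction f (reads f γ x0 α0 i S u).1 (reads f γ x0 α0 i S u).2 (i u) v
        else 0) (Finset.range t)).trans (Finset.sum_le_sum (g := fun u => (|γ| + 1) * |C u|)
        fun u hu => ?_)
      · linarith
      split_ifs
      · rw [abs_mul, abs_neg]
        have h3 := ((PiLp.norm_apply_le _ v).trans
          (hC u (Finset.mem_range.1 hu) i S (i u)).1).trans (le_abs_self _)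
        rw [Real.norm_eq_abs] at h3
        have h4 := abs_nonneg γ
        gcongr
        linarith
      · rw [abs_zero]
        exact hterm u hu
    · cases h : S.lastWriter f i t j v with
      | none =>
        rw [reads_snd_apply_of_none h]
        have h1 : |α0 j v| ≤ ‖α0 j‖ := PiLp.norm_apply_le (α0 j) v
        have h2 := norm_le_pi_norm α0 j
        have := Finset.sum_nonneg hterm
        linarith
      | some u =>
        rw [reads_snd_apply_of_some h]
        have h3 := ((PiLp.norm_apply_le _ v).trans (hC u u.isLt i S j).2).trans (le_abs_self _)
        rw [Real.norm_eq_abs] at h3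
        have h4 := Finset.single_le_sum hterm (Finset.mem_range.2 u.isLt)
        have h5 := mul_nonneg (abs_nonneg γ) (abs_nonneg (C u))
        linarith

end Execution

/-! ### Fresh samples -/

section BoundedMeasurable

variable {Ω E F : Type*} {m m' : MeasurableSpace Ω} [NormedAddCommGroup E] [NormedAddCommGroup F]

/-- Bounded functions that are strongly measurable for the σ-algebra `m`. -/
def BddMeas (m : MeasurableSpace Ω) (X : Ω → E) : Prop :=
  StronglyMeasurable[m] X ∧ ∃ C, ∀ ω, ‖X ω‖ ≤ C

namespace BddMeas

theorem mono {X : Ω → E} (h : BddMeas m X) (hm : m ≤ m') : BddMeas m' X :=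
  ⟨h.1.mono hm, h.2⟩

theorem const (c : E) : BddMeas m fun _ : Ω => c :=
  ⟨stronglyMeasurable_const, ‖c‖, fun _ => le_rfl⟩

theorem prodMk {X : Ω → E} {Y : Ω → F} (hX : BddMeas m X) (hY : BddMeas m Y) :
    BddMeas m fun ω => (X ω, Y ω) := by
  obtain ⟨C, hC⟩ := hX.2
  obtain ⟨D, hD⟩ := hY.2
  exact ⟨hX.1.prodMk hY.1, max C D, fun ω => max_le_max (hC ω) (hD ω)⟩

theorem comp [ProperSpace E] {X : Ω → E} (hX : BddMeas m X) {g : E → F} (hg : Continuous g) :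
    BddMeas m fun ω => g (X ω) := by
  obtain ⟨C, hC⟩ := hX.2
  obtain ⟨D, hD⟩ := (isCompact_closedBall (0 : E) C).exists_bound_of_continuousOn hg.continuousOn
  exact ⟨hg.comp_stronglyMeasurable hX.1, D, fun ω => hD _ (mem_closedBall_zero_iff.2 (hC ω))⟩

theorem mul {X Y : Ω → ℝ} (hX : BddMeas m X) (hY : BddMeas m Y) :
    BddMeas m fun ω => X ω * Y ω :=
  (hX.prodMk hY).comp (continuous_fst.mul continuous_snd)

theorem sub [ProperSpace E] {X Y : Ω → E} (hX : BddMeas m X) (hY : BddMeas m Y) :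
    BddMeas m fun ω => X ω - Y ω :=
  (hX.prodMk hY).comp (continuous_fst.sub continuous_snd)

theorem add [ProperSpace E] {X Y : Ω → E} (hX : BddMeas m X) (hY : BddMeas m Y) :
    BddMeas m fun ω => X ω + Y ω :=
  (hX.prodMk hY).comp (continuous_fst.add continuous_snd)

theorem sum [ProperSpace E] {ι : Type*} {s : Finset ι} {X : ι → Ω → E}
    (hX : ∀ k ∈ s, BddMeas m (X k)) : BddMeas m fun ω => ∑ k ∈ s, X k ω := by
  classical
  induction s using Finset.induction_on with
  | empty => simpa using const (m := m) (0 : E)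
  | insert k s hk ih =>
    simp_rw [Finset.sum_insert hk]
    exact (hX k (Finset.mem_insert_self k s)).add
      (ih fun l hl => hX l (Finset.mem_insert_of_mem hl))

theorem prod {ι : Type*} {s : Finset ι} {X : ι → Ω → ℝ}
    (hX : ∀ k ∈ s, BddMeas m (X k)) : BddMeas m fun ω => ∏ k ∈ s, X k ω := by
  classical
  induction s using Finset.induction_on with
  | empty => simpa using const (m := m) (1 : ℝ)
  | insert k s hk ih =>
    simp_rw [Finset.prod_insert hk]
    exact (hX k (Finset.mem_insert_self k s)).mul
      (ih fun l hl => hX l (Finset.mem_insert_of_mem hl))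

theorem ite_eq {n : ℕ} {I : Ω → Fin n} (hI : Measurable[m] I) (j : Fin n) (a b : ℝ) :
    BddMeas m fun ω => if I ω = j then a else b := by
  refine ⟨StronglyMeasurable.ite (hI (measurableSet_singleton j)) stronglyMeasurable_const
    stronglyMeasurable_const, max |a| |b|, fun ω => ?_⟩
  by_cases h : I ω = j
  · simp [h]
  · simp [h]

/-- Evaluation of a finite family at a measurable index. -/
theorem eval [NormedSpace ℝ E] [ProperSpace E] {n : ℕ} {I : Ω → Fin n} (hI : Measurable[m] I)
    {X : Fin n → Ω → E} (hX : ∀ j, BddMeas m (X j)) : BddMeas m fun ω => X (I ω) ω := by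
  have e : (fun ω => X (I ω) ω) = fun ω => ∑ j, (if I ω = j then (1 : ℝ) else 0) • X j ω := by
    ext ω
    simp
  rw [e]
  exact sum fun j _ => ((ite_eq hI j 1 0).prodMk (hX j)).comp
    (continuous_fst.smul continuous_snd)

theorem integrable {mΩ : MeasurableSpace Ω} {P : Measure Ω} [IsFiniteMeasure P] {X : Ω → E}
    (hX : BddMeas mΩ X) : Integrable X P := by
  obtain ⟨C, hC⟩ := hX.2
  exact Integrable.of_bound hX.1.aestronglyMeasurable C (Filter.Eventually.of_forall hC)

end BddMeas

end BoundedMeasurable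

section Sampling

variable {n d : ℕ} {Ω : Type*} {i : ℕ → Ω → Fin n} {R : ℕ → Ω → Vec d × (Fin n → Vec d)}

/-- The σ-algebra of everything read by the iterations `0, …, t` and sampled by the iterations
`0, …, t - 1`. -/
abbrev past (i : ℕ → Ω → Fin n) (R : ℕ → Ω → Vec d × (Fin n → Vec d)) (t : ℕ) : MeasurableSpace Ω :=
  MeasurableSpace.comap
    (fun ω => ((fun s : Fin t => i s ω), (fun s : Fin (t + 1) => R s ω))) inferInstance

theorem measurable_sample_past {s t : ℕ} (h : s < t) : Measurable[past i R t] (i s) := by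
  have h1 : Measurable fun z : (Fin t → Fin n) × (Fin (t + 1) → Vec d × (Fin n → Vec d)) =>
      z.1 ⟨s, h⟩ := by fun_prop
  exact h1.comp (comap_measurable _)

theorem measurable_read_past {s t : ℕ} (h : s ≤ t) : Measurable[past i R t] (R s) := by
  have h1 : Measurable fun z : (Fin t → Fin n) × (Fin (t + 1) → Vec d × (Fin n → Vec d)) =>
      z.2 ⟨s, Nat.lt_succ_of_le h⟩ := by fun_prop
  exact h1.comp (comap_measurable _)

theorem past_le_of_measurable [m : MeasurableSpace Ω] {t : ℕ} (h1 : ∀ s < t, Measurable (i s))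
    (h2 : ∀ s ≤ t, Measurable (R s)) : past i R t ≤ m :=
  Measurable.comap_le ((measurable_pi_lambda _ fun u : Fin t => h1 u u.isLt).prodMk
    (measurable_pi_lambda _ fun u : Fin (t + 1) => h2 u (Nat.lt_succ_iff.1 u.isLt)))

theorem past_mono {s t : ℕ} (h : s ≤ t) : past i R s ≤ past i R t :=
  past_le_of_measurable (m := past i R t) (fun _ hu => measurable_sample_past (hu.trans_le h))
    fun _ hu => measurable_read_past (hu.trans h)

theorem FreshSampling.past_le [mΩ : MeasurableSpace Ω] {P : Measure Ω} (hi : FreshSampling P i R)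
    (t : ℕ) : past i R t ≤ mΩ :=
  past_le_of_measurable (fun s _ => hi.measurable_sample s) fun s _ => hi.measurable_read s

variable [mΩ : MeasurableSpace Ω] {P : Measure Ω}

theorem FreshSampling.integral_mul_ite (hi : FreshSampling P i R) {t : ℕ} {X : Ω → ℝ}
    (hX : BddMeas (past i R t) X) (j : Fin n) :
    ∫ ω, X ω * (if i t ω = j then 1 else 0) ∂P = 1 / n * ∫ ω, X ω ∂P := by
  have hind : IndepFun X (fun ω => if i t ω = j then (1 : ℝ) else 0) P := by
    refine (IndepFun_iff_Indep _ _ _).2 ?_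
    have h := (IndepFun_iff_Indep _ _ _).1 (hi.indep t).symm
    refine indep_of_indep_of_le_left (indep_of_indep_of_le_right h ?_) ?_
    · refine Measurable.comap_le (m₁ := MeasurableSpace.comap (i t) inferInstance) ?_
      exact (measurable_from_top (f := fun k : Fin n => if k = j then (1 : ℝ) else 0)).comp
        (comap_measurable (i t))
    · exact Measurable.comap_le (m₁ := past i R t) hX.1.measurable
  rw [hind.integral_fun_mul_eq_mul_integral (hX.mono (hi.past_le t)).1.aestronglyMeasurable
    (BddMeas.ite_eq (hi.measurable_sample t) j 1 0).1.aestronglyMeasurable, mul_comm]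
  congr 1
  have hset : MeasurableSet {ω | i t ω = j} := hi.measurable_sample t (measurableSet_singleton j)
  have e : (fun ω => if i t ω = j then (1 : ℝ) else 0) = {ω | i t ω = j}.indicator 1 := by
    ext ω
    simp [Set.indicator_apply]
  rw [e, integral_indicator_one hset, Measure.real, hi.uniform t j]
  simp

variable [IsProbabilityMeasure P]

/-- A fresh sample is averaged out uniformly. -/
theorem FreshSampling.integral_eval (hi : FreshSampling P i R) {t : ℕ} {X : Fin n → Ω → ℝ}
    (hX : ∀ j, BddMeas (past i R t) (X j)) :
    ∫ ω, X (i t ω) ω ∂P = ∫ ω, 1 / (n : ℝ) * ∑ j, X j ω ∂P := by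
  have e : (fun ω => X (i t ω) ω) = fun ω => ∑ j, X j ω * (if i t ω = j then 1 else 0) := by
    ext ω
    simp
  have hX' := fun j => (hX j).mono (hi.past_le t)
  rw [e, integral_finsetSum _ fun j _ =>
    ((hX' j).mul (BddMeas.ite_eq (hi.measurable_sample t) j 1 0)).integrable,
    integral_const_mul, integral_finsetSum _ fun j _ => (hX' j).integrable, Finset.mul_sum]
  exact Finset.sum_congr rfl fun j _ => hi.integral_mul_ite (hX j) j

theorem FreshSampling.integral_mul_avoid (hi : FreshSampling P i R) {a : ℕ} {Y : Ω → ℝ}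
    (hY : BddMeas (past i R a) Y) (j : Fin n) (b : ℕ) :
    ∫ ω, Y ω * avoid (fun s => i s ω) j (Finset.Ico a b) ∂P
      = (1 - 1 / (n : ℝ)) ^ (b - a) * ∫ ω, Y ω ∂P := by
  rcases le_total b a with hba | hab
  · simp [Finset.Ico_eq_empty_of_le hba, avoid, Nat.sub_eq_zero_of_le hba]
  induction b, hab using Nat.le_induction with
  | base => simp [avoid]
  | succ b hab ih =>
    set Z : Ω → ℝ := fun ω => Y ω * avoid (fun s => i s ω) j (Finset.Ico a b) with hZ
    have hZm : BddMeas (past i R b) Z :=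
      (hY.mono (past_mono hab)).mul (BddMeas.prod fun w hw =>
        BddMeas.ite_eq (measurable_sample_past (Finset.mem_Ico.1 hw).2) j 0 1)
    have e : (fun ω => Y ω * avoid (fun s => i s ω) j (Finset.Ico a (b + 1)))
        = fun ω => Z ω - Z ω * (if i b ω = j then 1 else 0) := by
      ext ω
      simp only [hZ, avoid, Finset.prod_Ico_succ_top hab]
      split_ifs <;> ring
    have hZi := hZm.mono (hi.past_le b)
    rw [e, integral_sub hZi.integrable
      (hZi.mul (BddMeas.ite_eq (hi.measurable_sample b) j 1 0)).integrable,
      hi.integral_mul_ite hZm, ih, Nat.succ_sub hab, pow_succ]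
    ring

/-- The probability that the index `j` is sampled at time `u` and then avoided during `[a, b)`,
weighted by a past variable. The truncated exponent `b - a` is right: an empty window costs
nothing. -/
theorem FreshSampling.integral_mul_ite_mul_avoid (hi : FreshSampling P i R) {u a : ℕ}
    (hua : u < a) {X : Ω → ℝ} (hX : BddMeas (past i R u) X) (j : Fin n) (b : ℕ) :
    ∫ ω, X ω * (if i u ω = j then 1 else 0) * avoid (fun s => i s ω) j (Finset.Ico a b) ∂P
      = (1 - 1 / (n : ℝ)) ^ (b - a) * (1 / n * ∫ ω, X ω ∂P) := by
  rw [hi.integral_mul_avoid ((hX.mono (past_mono hua.le)).mul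
    (BddMeas.ite_eq (measurable_sample_past hua) j 1 0)), hi.integral_mul_ite hX]

end Sampling

/-! ### Expected progress of one iteration -/

section Progress

variable {n d : ℕ} {Ω : Type*} {f : Fin n → Vec d → ℝ} {γ : ℝ}
  {x0 : Vec d} {α0 : Fin n → Vec d} {S : Ω → Schedule n d} {i : ℕ → Ω → Fin n}

/-- The values `(x̂_t, α̂^t)` as a random process. -/
noncomputable def readProc (f : Fin n → Vec d → ℝ) (γ : ℝ) (x0 : Vec d) (α0 : Fin n → Vec d)
    (i : ℕ → Ω → Fin n) (S : Ω → Schedule n d) (t : ℕ) (ω : Ω) : Vec d × (Fin n → Vec d) :=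
  reads f γ x0 α0 (fun s => i s ω) (S ω) t

/-- The updates as a random process. -/
noncomputable def updateProc (f : Fin n → Vec d → ℝ) (γ : ℝ) (x0 : Vec d) (α0 : Fin n → Vec d)
    (i : ℕ → Ω → Fin n) (S : Ω → Schedule n d) (t : ℕ) (ω : Ω) : Vec d :=
  update f γ x0 α0 (fun s => i s ω) (S ω) t

/-- The virtual iterates as a random process. -/
noncomputable def virtualProc (f : Fin n → Vec d → ℝ) (γ : ℝ) (x0 : Vec d) (α0 : Fin n → Vec d)
    (i : ℕ → Ω → Fin n) (S : Ω → Schedule n d) (t : ℕ) (ω : Ω) : Vec d :=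
  virtualIterate f γ x0 α0 (fun s => i s ω) (S ω) t

local notation "X̂" => readProc f γ x0 α0 i S
local notation "𝐠" => updateProc f γ x0 α0 i S
local notation "𝐱" => virtualProc f γ x0 α0 i S

theorem bddMeas_read (hcont : ∀ j, Continuous (gradient (f j))) {s t : ℕ} (h : s ≤ t) :
    BddMeas (past i X̂ t) (X̂ s) := by
  obtain ⟨B, hB⟩ := exists_norm_reads_le hcont γ x0 α0 s
  exact ⟨(measurable_read_past h).stronglyMeasurable, B, fun ω => hB _ _⟩

theorem bddMeas_update (hcont : ∀ j, Continuous (gradient (f j))) {s t : ℕ} (h : s < t) :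
    BddMeas (past i X̂ t) (𝐠 s) :=
  BddMeas.eval (measurable_sample_past h)
    (X := fun j ω => direction f (X̂ s ω).1 (X̂ s ω).2 j)
    fun j => (bddMeas_read hcont h.le).comp (continuous_direction hcont j)

theorem bddMeas_virtual (hcont : ∀ j, Continuous (gradient (f j))) (t : ℕ) :
    BddMeas (past i X̂ t) (𝐱 t) :=
  (BddMeas.sum fun _ hu => bddMeas_update hcont (Finset.mem_range.1 hu)).comp
    (g := fun z => x0 - γ • z) (by fun_prop)

variable [mΩ : MeasurableSpace Ω] {P : Measure Ω}

/-- The coordinatewise overlap `∑ v, |[x]_v| |[y]_v|`, which bounds the inner product of `x` and `y`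
after any masking of coordinates. -/
def overlap (x y : Vec d) : ℝ := ∑ v, |x v| * |y v|

theorem overlap_comm (x y : Vec d) : overlap x y = overlap y x :=
  Finset.sum_congr rfl fun _ _ => mul_comm _ _

theorem overlap_self (x : Vec d) : overlap x x = ‖x‖ ^ 2 := by
  rw [EuclideanSpace.real_norm_sq_eq]
  exact Finset.sum_congr rfl fun v _ => by rw [← sq, sq_abs]

theorem continuous_overlap : Continuous fun p : Vec d × Vec d => overlap p.1 p.2 := by
  unfold overlap
  fun_prop

theorem bddMeas_overlap (hcont : ∀ j, Continuous (gradient (f j))) (hi : FreshSampling P i X̂)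
    (u w : ℕ) : BddMeas mΩ fun ω => overlap (𝐠 u ω) (𝐠 w ω) :=
  (((bddMeas_update hcont (Nat.lt_succ_self u)).mono (hi.past_le _)).prodMk
    ((bddMeas_update hcont (Nat.lt_succ_self w)).mono (hi.past_le _))).comp continuous_overlap

variable [IsProbabilityMeasure P]

theorem integral_inner_update (hn : 0 < n) (hdiff : ∀ j, Differentiable ℝ (f j))
    (hcont : ∀ j, Continuous (gradient (f j))) (hα0 : ∀ j, ∀ v ∉ support (f j), α0 j v = 0)
    (hi : FreshSampling P i X̂) (y : Vec d) (t : ℕ) :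
    ∫ ω, inner ℝ ((X̂ t ω).1 - y) (𝐠 t ω) ∂P
      = ∫ ω, inner ℝ ((X̂ t ω).1 - y) (gradient (objective f) (X̂ t ω).1) ∂P := by
  have h := hi.integral_eval (t := t)
    (X := fun j ω => inner ℝ ((X̂ t ω).1 - y) (direction f (X̂ t ω).1 (X̂ t ω).2 j))
    fun j => (bddMeas_read hcont le_rfl).comp
      (g := fun p => inner ℝ (p.1 - y) (direction f p.1 p.2 j))
      ((continuous_fst.sub continuous_const).inner (continuous_direction hcont j))
  refine h.trans (integral_congr_ae (Filter.Eventually.of_forall fun ω => ?_))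
  exact mean_inner_direction hn hdiff (reads_snd_apply_eq_zero hα0 t) _ _

/-- Mean squared error of the table that is read: old gradients are forgotten geometrically, after a
delay. -/
theorem integral_norm_table_sub_sq_le {τ : ℕ} (hcont : ∀ j, Continuous (gradient (f j)))
    (hα0 : ∀ j, ∀ v ∉ support (f j), α0 j v = 0) (hS : ∀ ω, (S ω).BoundedOverlap τ)
    (hi : FreshSampling P i X̂) (t : ℕ) (j : Fin n) {c : Vec d}
    (hc : ∀ v ∉ support (f j), c v = 0) :
    ∫ ω, ‖(X̂ t ω).2 j - c‖ ^ 2 ∂P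
      ≤ ∑ u ∈ Finset.range t, (1 - 1 / (n : ℝ)) ^ (t - τ - (u + τ + 1)) *
          (1 / n * ∫ ω, ‖gradient (f j) (X̂ u ω).1 - c‖ ^ 2 ∂P)
        + (1 - 1 / (n : ℝ)) ^ (t - τ) * ‖α0 j - c‖ ^ 2 := by
  have hgm : ∀ u, BddMeas (past i X̂ u) fun ω => ‖gradient (f j) (X̂ u ω).1 - c‖ ^ 2 := fun u =>
    (bddMeas_read hcont le_rfl).comp (g := fun p => ‖gradient (f j) p.1 - c‖ ^ 2)
      ((((hcont j).comp continuous_fst).sub continuous_const).norm.pow 2)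
  have havoid : ∀ s, BddMeas mΩ fun ω => avoid (fun s => i s ω) j s := fun s =>
    BddMeas.prod fun w _ => BddMeas.ite_eq (hi.measurable_sample w) j 0 1
  have hterm : ∀ u ∈ Finset.range t, Integrable (fun ω => ‖gradient (f j) (X̂ u ω).1 - c‖ ^ 2
      * (if i u ω = j then 1 else 0)
      * avoid (fun s => i s ω) j (Finset.Ico (u + τ + 1) (t - τ))) P := fun u _ =>
    ((((hgm u).mono (hi.past_le u)).mul (BddMeas.ite_eq (hi.measurable_sample u) j 1 0)).mul
      (havoid _)).integrable
  have hinit : Integrable (fun ω => ‖α0 j - c‖ ^ 2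
      * avoid (fun s => i s ω) j (Finset.Ico 0 (t - τ))) P :=
    ((BddMeas.const _).mul (havoid _)).integrable
  have hlhs : Integrable (fun ω => ‖(X̂ t ω).2 j - c‖ ^ 2) P :=
    (((bddMeas_read hcont le_rfl).mono (hi.past_le t)).comp
      (g := fun p => ‖p.2 j - c‖ ^ 2) (by fun_prop)).integrable
  refine (integral_mono hlhs ((integrable_finsetSum _ hterm).add hinit) fun ω =>
    norm_reads_snd_sub_sq_le (hS ω) hα0 t j hc).trans_eq ?_
  simp only [Pi.add_apply]
  rw [integral_add (integrable_finsetSum _ hterm) hinit, integral_finsetSum _ hterm]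
  congr 1
  · refine Finset.sum_congr rfl fun u _ => ?_
    exact hi.integral_mul_ite_mul_avoid (by omega) (hgm u) j _
  · rw [hi.integral_mul_avoid (BddMeas.const _) j, Nat.sub_zero]
    simp

/-- The second moment of the update, bounded by the present and the past suboptimality. -/
theorem integral_norm_update_sq_le {τ : ℕ} (hn : 0 < n) {L : ℝ} (hL : 0 < L)
    (hconvex : ∀ j, ConvexOn ℝ Set.univ (f j)) (hdiff : ∀ j, Differentiable ℝ (f j))
    (hsmooth : ∀ j x y, ‖gradient (f j) x - gradient (f j) y‖ ≤ L * ‖x - y‖) {xstar : Vec d}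
    (hxstar : ∀ x, objective f xstar ≤ objective f x)
    (hα0 : ∀ j, ∀ v ∉ support (f j), α0 j v = 0) (hS : ∀ ω, (S ω).BoundedOverlap τ)
    (hi : FreshSampling P i X̂) (t : ℕ) :
    ∫ ω, ‖𝐠 t ω‖ ^ 2 ∂P
      ≤ 4 * L * ∫ ω, (objective f (X̂ t ω).1 - objective f xstar) ∂P
        + 4 * L / n * ∑ u ∈ Finset.range t, (1 - 1 / (n : ℝ)) ^ (t - τ - (u + τ + 1))
          * ∫ ω, (objective f (X̂ u ω).1 - objective f xstar) ∂P
        + 2 * (1 - 1 / (n : ℝ)) ^ (t - τ)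
          * (1 / (n : ℝ) * ∑ j, ‖α0 j - gradient (f j) xstar‖ ^ 2) := by
  have hn' : (0 : ℝ) < n := by exact_mod_cast hn
  have hq : 0 ≤ 1 - 1 / (n : ℝ) := by
    rw [sub_nonneg, div_le_one hn']
    exact_mod_cast hn
  have hcont := fun j => continuous_gradient_of_lipschitz (hsmooth j)
  have hR : ∀ u, BddMeas mΩ (X̂ u) := fun u => (bddMeas_read hcont le_rfl).mono (hi.past_le u)
  set c : Fin n → Vec d := fun j => gradient (f j) xstar with hc
  have hcs : ∀ j, ∀ v ∉ support (f j), c j v = 0 := fun j v hv => gradient_apply_eq_zero hv _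
  have hgi : ∀ u j, Integrable (fun ω => ‖gradient (f j) (X̂ u ω).1 - c j‖ ^ 2) P := fun u j =>
    ((hR u).comp (g := fun p => ‖gradient (f j) p.1 - c j‖ ^ 2)
      ((((hcont j).comp continuous_fst).sub continuous_const).norm.pow 2)).integrable
  have hai : ∀ j, Integrable (fun ω => ‖(X̂ t ω).2 j - c j‖ ^ 2) P := fun j =>
    ((hR t).comp (g := fun p => ‖p.2 j - c j‖ ^ 2) (by fun_prop)).integrable
  have hoi : ∀ u, Integrable (fun ω => objective f (X̂ u ω).1 - objective f xstar) P := fun u =>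
    ((hR u).comp (g := fun p => objective f p.1 - objective f xstar)
      (((differentiable_objective hdiff).continuous.comp continuous_fst).sub
        continuous_const)).integrable
  have hmean : ∀ u, 1 / (n : ℝ) * ∑ j, ∫ ω, ‖gradient (f j) (X̂ u ω).1 - c j‖ ^ 2 ∂P
      ≤ 2 * L * ∫ ω, (objective f (X̂ u ω).1 - objective f xstar) ∂P := fun u => by
    rw [← integral_finsetSum _ fun j _ => hgi u j, ← integral_const_mul, ← integral_const_mul]
    exact integral_mono ((integrable_finsetSum _ fun j _ => hgi u j).const_mul _)
      ((hoi u).const_mul _) fun ω =>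
      mean_norm_gradient_sub_sq_le hn hL hconvex hdiff hsmooth hxstar _
  have htable : 1 / (n : ℝ) * ∑ j, ∫ ω, ‖(X̂ t ω).2 j - c j‖ ^ 2 ∂P
      ≤ 2 * L / n * ∑ u ∈ Finset.range t, (1 - 1 / (n : ℝ)) ^ (t - τ - (u + τ + 1))
          * ∫ ω, (objective f (X̂ u ω).1 - objective f xstar) ∂P
        + (1 - 1 / (n : ℝ)) ^ (t - τ) * (1 / (n : ℝ) * ∑ j, ‖α0 j - c j‖ ^ 2) := by
    refine (mul_le_mul_of_nonneg_left (Finset.sum_le_sum fun j _ =>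
      integral_norm_table_sub_sq_le hcont hα0 hS hi t j (hcs j)) (by positivity)).trans ?_
    rw [Finset.sum_add_distrib, Finset.sum_comm, mul_add, ← Finset.mul_sum, mul_left_comm,
      Finset.mul_sum, Finset.mul_sum _ _ (2 * L / (n : ℝ))]
    refine add_le_add (Finset.sum_le_sum fun u _ => ?_) le_rfl
    rw [← Finset.mul_sum, ← Finset.mul_sum]
    have h := mul_le_mul_of_nonneg_left (hmean u)
      (mul_nonneg (pow_nonneg hq (t - τ - (u + τ + 1))) (by positivity : 0 ≤ 1 / (n : ℝ)))
    calc _ = _ := by ring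
      _ ≤ _ := h
      _ = _ := by ring
  have hstep : ∫ ω, ‖𝐠 t ω‖ ^ 2 ∂P
      = ∫ ω, 1 / (n : ℝ) * ∑ j, ‖direction f (X̂ t ω).1 (X̂ t ω).2 j‖ ^ 2 ∂P :=
    hi.integral_eval (t := t) (X := fun j ω => ‖direction f (X̂ t ω).1 (X̂ t ω).2 j‖ ^ 2)
      fun j => (bddMeas_read hcont le_rfl).comp (g := fun p => ‖direction f p.1 p.2 j‖ ^ 2)
        ((continuous_direction hcont j).norm.pow 2)
  have hdi : Integrable (fun ω =>
      1 / (n : ℝ) * ∑ j, ‖direction f (X̂ t ω).1 (X̂ t ω).2 j‖ ^ 2) P :=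
    (integrable_finsetSum _ fun j _ => ((hR t).comp (g := fun p => ‖direction f p.1 p.2 j‖ ^ 2)
        ((continuous_direction hcont j).norm.pow 2)).integrable).const_mul _
  have hsplit : ∫ ω, 1 / (n : ℝ) * ∑ j, ‖direction f (X̂ t ω).1 (X̂ t ω).2 j‖ ^ 2 ∂P
      ≤ 2 * (1 / (n : ℝ) * ∑ j, ∫ ω, ‖gradient (f j) (X̂ t ω).1 - c j‖ ^ 2 ∂P)
        + 2 * (1 / (n : ℝ) * ∑ j, ∫ ω, ‖(X̂ t ω).2 j - c j‖ ^ 2 ∂P) := by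
    rw [← integral_finsetSum _ fun j _ => hgi t j, ← integral_finsetSum _ fun j _ => hai j,
      ← integral_const_mul, ← integral_const_mul, ← integral_const_mul, ← integral_const_mul,
      ← integral_add (((integrable_finsetSum _ fun j _ => hgi t j).const_mul _).const_mul _)
        (((integrable_finsetSum _ fun j _ => hai j).const_mul _).const_mul _)]
    refine integral_mono hdi
      ((((integrable_finsetSum _ fun j _ => hgi t j).const_mul _).const_mul _).add
        (((integrable_finsetSum _ fun j _ => hai j).const_mul _).const_mul _)) fun ω => ?_
    have h := mul_le_mul_of_nonneg_left (sum_norm_direction_sq_le hn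
      (reads_snd_apply_eq_zero (γ := γ) (x0 := x0) (i := fun s => i s ω) (S := S ω) hα0 t) hcs
      (sum_gradient_minimizer hn hdiff hxstar) (X̂ t ω).1) (by positivity : 0 ≤ 1 / (n : ℝ))
    refine h.trans_eq ?_
    simp only [readProc]
    ring
  have h1 := hmean t
  rw [hstep]
  refine hsplit.trans ?_
  have e : 4 * L / n * ∑ u ∈ Finset.range t, (1 - 1 / (n : ℝ)) ^ (t - τ - (u + τ + 1))
          * ∫ ω, (objective f (X̂ u ω).1 - objective f xstar) ∂P
      = 2 * (2 * L / n * ∑ u ∈ Finset.range t, (1 - 1 / (n : ℝ)) ^ (t - τ - (u + τ + 1))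
          * ∫ ω, (objective f (X̂ u ω).1 - objective f xstar) ∂P) := by ring
  rw [e]
  linarith

open Classical in
/-- Two different updates have little overlap on average, since the later one is supported on a
fresh random factor. -/
theorem integral_overlap_le_of_lt (hn : 0 < n) (hΔ : 0 < sparsity f)
    (hcont : ∀ j, Continuous (gradient (f j))) (hα0 : ∀ j, ∀ v ∉ support (f j), α0 j v = 0)
    (hi : FreshSampling P i X̂) {u t : ℕ} (hut : u < t) :
    ∫ ω, overlap (𝐠 u ω) (𝐠 t ω) ∂P
      ≤ √(sparsity f) / 2 * (∫ ω, ‖𝐠 u ω‖ ^ 2 ∂P + ∫ ω, ‖𝐠 t ω‖ ^ 2 ∂P) := by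
  have hn' : (0 : ℝ) < n := by exact_mod_cast hn
  set s := √(sparsity f) with hs
  have hs0 : 0 < s := Real.sqrt_pos.2 hΔ
  have hss : s * s = sparsity f := Real.mul_self_sqrt hΔ.le
  have hgb : ∀ u, BddMeas mΩ (𝐠 u) := fun u =>
    (bddMeas_update hcont (Nat.lt_succ_self u)).mono (hi.past_le _)
  have hg2 : ∀ u, Integrable (fun ω => ‖𝐠 u ω‖ ^ 2) P := fun u =>
    ((hgb u).comp (g := fun z => ‖z‖ ^ 2) (by fun_prop)).integrable
  let m : Fin n → Vec d → ℝ := fun j z => ∑ v, if v ∈ support (f j) then (z v) ^ 2 else 0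
  have hm : ∀ j, Continuous (m j) := fun j => by
    refine continuous_finsetSum _ fun v _ => ?_
    split_ifs
    · fun_prop
    · exact continuous_const
  have hmb : ∀ j, BddMeas (past i X̂ t) fun ω => m j (𝐠 u ω) := fun j =>
    (bddMeas_update hcont hut).comp (hm j)
  have hmi : Integrable (fun ω => m (i t ω) (𝐠 u ω)) P :=
    (BddMeas.eval (hi.measurable_sample t) fun j => (hmb j).mono (hi.past_le t)).integrable
  have hmask : ∫ ω, m (i t ω) (𝐠 u ω) ∂P ≤ sparsity f * ∫ ω, ‖𝐠 u ω‖ ^ 2 ∂P := by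
    rw [hi.integral_eval hmb, ← integral_const_mul]
    refine integral_mono ((integrable_finsetSum _ fun j _ =>
      ((hmb j).mono (hi.past_le t)).integrable).const_mul _) ((hg2 u).const_mul _) fun ω => ?_
    simp only [m]
    rw [Finset.sum_comm, EuclideanSpace.real_norm_sq_eq, Finset.mul_sum, Finset.mul_sum]
    refine Finset.sum_le_sum fun v _ => ?_
    rw [← Finset.sum_filter, Finset.sum_const, card_filter_support, nsmul_eq_mul]
    have h := mul_le_mul_of_nonneg_right (coordProb_le_sparsity (f := f) v)
      (sq_nonneg (𝐠 u ω v))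
    refine le_trans (le_of_eq ?_) h
    rw [coordProb]
    ring
  have hpt : ∀ ω, overlap (𝐠 u ω) (𝐠 t ω)
      ≤ 1 / (2 * s) * m (i t ω) (𝐠 u ω) + s / 2 * ‖𝐠 t ω‖ ^ 2 := fun ω => by
    simp only [m, overlap]
    rw [EuclideanSpace.real_norm_sq_eq, Finset.mul_sum, Finset.mul_sum, ← Finset.sum_add_distrib]
    refine Finset.sum_le_sum fun v _ => ?_
    split_ifs with hv
    -- the weights balance the factor `Δ = s ^ 2` that the mask gains on average
    · rw [← sq_abs (𝐠 u ω v), ← sq_abs (𝐠 t ω v)]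
      have e : 1 / (2 * s) * |𝐠 u ω v| ^ 2 + s / 2 * |𝐠 t ω v| ^ 2 - |𝐠 u ω v| * |𝐠 t ω v|
          = 1 / (2 * s) * (|𝐠 u ω v| - s * |𝐠 t ω v|) ^ 2 := by
        field_simp
        ring
      have : 0 ≤ 1 / (2 * s) * (|𝐠 u ω v| - s * |𝐠 t ω v|) ^ 2 := by positivity
      linarith
    · have h0 : 𝐠 t ω v = 0 := update_apply_eq_zero hα0 hv
      simp [h0]
  refine (integral_mono (bddMeas_overlap hcont hi u t).integrable
    ((hmi.const_mul _).add ((hg2 t).const_mul _)) hpt).trans ?_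
  simp only [Pi.add_apply]
  rw [integral_add (hmi.const_mul _) ((hg2 t).const_mul _), integral_const_mul, integral_const_mul]
  have h := mul_le_mul_of_nonneg_left hmask (by positivity : 0 ≤ 1 / (2 * s))
  rw [← hss] at h
  have e : 1 / (2 * s) * (s * s * ∫ ω, ‖𝐠 u ω‖ ^ 2 ∂P) = s / 2 * ∫ ω, ‖𝐠 u ω‖ ^ 2 ∂P := by
    field_simp
  rw [e] at h
  linarith

theorem integral_overlap_le_of_ne (hn : 0 < n) (hΔ : 0 < sparsity f)
    (hcont : ∀ j, Continuous (gradient (f j))) (hα0 : ∀ j, ∀ v ∉ support (f j), α0 j v = 0)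
    (hi : FreshSampling P i X̂) {u t : ℕ} (hut : u ≠ t) :
    ∫ ω, overlap (𝐠 u ω) (𝐠 t ω) ∂P
      ≤ √(sparsity f) / 2 * (∫ ω, ‖𝐠 u ω‖ ^ 2 ∂P + ∫ ω, ‖𝐠 t ω‖ ^ 2 ∂P) := by
  rcases hut.lt_or_gt with h | h
  · exact integral_overlap_le_of_lt hn hΔ hcont hα0 hi h
  · simp_rw [overlap_comm (𝐠 u _)]
    rw [add_comm]
    exact integral_overlap_le_of_lt hn hΔ hcont hα0 hi h

theorem card_window_le (τ t : ℕ) : ((Finset.Ico (t - τ) t).card : ℝ) ≤ τ := by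
  rw [Nat.card_Ico]
  exact_mod_cast (by omega : t - (t - τ) ≤ τ)

theorem integral_inner_displacement_le {τ : ℕ} (hn : 0 < n) (hΔ : 0 < sparsity f) (hγ : 0 ≤ γ)
    (hcont : ∀ j, Continuous (gradient (f j))) (hα0 : ∀ j, ∀ v ∉ support (f j), α0 j v = 0)
    (hS : ∀ ω, (S ω).BoundedOverlap τ) (hi : FreshSampling P i X̂) (t : ℕ) :
    ∫ ω, inner ℝ ((X̂ t ω).1 - 𝐱 t ω) (𝐠 t ω) ∂P
      ≤ γ * (√(sparsity f) / 2) * (∑ u ∈ Finset.Ico (t - τ) t, ∫ ω, ‖𝐠 u ω‖ ^ 2 ∂P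
        + τ * ∫ ω, ‖𝐠 t ω‖ ^ 2 ∂P) := by
  have hov := fun u => (bddMeas_overlap (P := P) hcont hi u t).integrable (P := P)
  have hint : Integrable (fun ω => inner ℝ ((X̂ t ω).1 - 𝐱 t ω) (𝐠 t ω)) P :=
    (((((bddMeas_read hcont le_rfl).mono (hi.past_le t)).comp continuous_fst).sub
      ((bddMeas_virtual hcont t).mono (hi.past_le t))).prodMk
      ((bddMeas_update hcont (Nat.lt_succ_self t)).mono (hi.past_le _))).comp
      (g := fun p => inner ℝ p.1 p.2) (by fun_prop) |>.integrable
  have hpt : ∀ ω, inner ℝ ((X̂ t ω).1 - 𝐱 t ω) (𝐠 t ω)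
      ≤ γ * ∑ u ∈ Finset.Ico (t - τ) t, overlap (𝐠 u ω) (𝐠 t ω) := fun ω => by
    simp only [overlap]
    rw [PiLp.inner_apply, Finset.sum_comm, Finset.mul_sum]
    refine Finset.sum_le_sum fun v _ => ?_
    have h := abs_reads_sub_virtualIterate_le (x0 := x0) (i := fun s => i s ω) (hS ω) hγ hα0 t v
    rw [← Finset.sum_mul, ← mul_assoc]
    exact (real_inner_le_norm _ _).trans (mul_le_mul_of_nonneg_right h (abs_nonneg _))
  refine (integral_mono hint ((integrable_finsetSum _ fun u _ => hov u).const_mul _) hpt).trans ?_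
  rw [integral_const_mul, integral_finsetSum _ fun u _ => hov u, mul_assoc]
  refine mul_le_mul_of_nonneg_left ?_ hγ
  refine (Finset.sum_le_sum fun u hu => integral_overlap_le_of_ne hn hΔ hcont hα0 hi
    (Finset.mem_Ico.1 hu).2.ne).trans ?_
  rw [← Finset.mul_sum, Finset.sum_add_distrib, Finset.sum_const, nsmul_eq_mul]
  refine mul_le_mul_of_nonneg_left (add_le_add le_rfl ?_) (by positivity)
  exact mul_le_mul_of_nonneg_right (card_window_le τ t)
    (integral_nonneg fun ω => by positivity)

theorem integral_norm_displacement_sq_le {τ : ℕ} (hn : 0 < n) (hΔ : 0 < sparsity f) (hγ : 0 ≤ γ)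
    (hcont : ∀ j, Continuous (gradient (f j))) (hα0 : ∀ j, ∀ v ∉ support (f j), α0 j v = 0)
    (hS : ∀ ω, (S ω).BoundedOverlap τ) (hi : FreshSampling P i X̂) (t : ℕ) :
    ∫ ω, ‖(X̂ t ω).1 - 𝐱 t ω‖ ^ 2 ∂P
      ≤ γ ^ 2 * (1 + τ * √(sparsity f)) * ∑ u ∈ Finset.Ico (t - τ) t, ∫ ω, ‖𝐠 u ω‖ ^ 2 ∂P := by
  have hov := fun u w => (bddMeas_overlap (P := P) hcont hi u w).integrable (P := P)
  have hint : Integrable (fun ω => ‖(X̂ t ω).1 - 𝐱 t ω‖ ^ 2) P :=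
    ((((bddMeas_read hcont le_rfl).mono (hi.past_le t)).comp continuous_fst).sub
      ((bddMeas_virtual hcont t).mono (hi.past_le t))).comp
      (g := fun z => ‖z‖ ^ 2) (by fun_prop) |>.integrable
  set W := Finset.Ico (t - τ) t with hW
  set G : ℕ → ℝ := fun u => ∫ ω, ‖𝐠 u ω‖ ^ 2 ∂P with hG
  have hG0 : ∀ u, 0 ≤ G u := fun u => integral_nonneg fun ω => by positivity
  have hpt : ∀ ω, ‖(X̂ t ω).1 - 𝐱 t ω‖ ^ 2
      ≤ γ ^ 2 * ∑ u ∈ W, ∑ w ∈ W, overlap (𝐠 u ω) (𝐠 w ω) := fun ω => by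
    have e : ∑ u ∈ W, ∑ w ∈ W, overlap (𝐠 u ω) (𝐠 w ω) = ∑ v, (∑ u ∈ W, |𝐠 u ω v|) ^ 2 := by
      simp only [overlap]
      simp_rw [sq, Finset.sum_mul_sum]
      rw [Finset.sum_comm (t := W)]
      simp_rw [Finset.sum_comm (s := W) (t := Finset.univ)]
      refine Finset.sum_congr rfl fun v _ => Finset.sum_comm
    rw [e, EuclideanSpace.real_norm_sq_eq, Finset.mul_sum]
    refine Finset.sum_le_sum fun v _ => ?_
    have h := abs_reads_sub_virtualIterate_le (x0 := x0) (i := fun s => i s ω) (hS ω) hγ hα0 t v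
    rw [← mul_pow]
    exact sq_le_sq' (abs_le.1 h).1 (abs_le.1 h).2
  refine (integral_mono hint ((integrable_finsetSum _ fun u _ =>
    integrable_finsetSum _ fun w _ => hov u w).const_mul _) hpt).trans ?_
  rw [integral_const_mul, integral_finsetSum _ fun u _ => integrable_finsetSum _ fun w _ => hov u w,
    mul_assoc]
  refine mul_le_mul_of_nonneg_left ?_ (sq_nonneg γ)
  simp_rw [fun u => integral_finsetSum W fun w _ => hov u w]
  have hpair : ∀ u w, ∫ ω, overlap (𝐠 u ω) (𝐠 w ω) ∂P
      ≤ (if u = w then G u else 0) + √(sparsity f) / 2 * (G u + G w) := fun u w => by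
    split_ifs with h
    · subst h
      simp_rw [overlap_self]
      have : 0 ≤ √(sparsity f) / 2 * (G u + G u) :=
        mul_nonneg (by positivity) (add_nonneg (hG0 u) (hG0 u))
      linarith
    · rw [zero_add]
      exact integral_overlap_le_of_ne hn hΔ hcont hα0 hi h
  refine (Finset.sum_le_sum fun u _ => Finset.sum_le_sum fun w _ => hpair u w).trans ?_
  have e1 : ∑ u ∈ W, ∑ w ∈ W, ((if u = w then G u else 0) + √(sparsity f) / 2 * (G u + G w))
      = ∑ u ∈ W, G u + W.card * √(sparsity f) * ∑ u ∈ W, G u := by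
    simp_rw [Finset.sum_add_distrib, ← Finset.mul_sum, Finset.sum_add_distrib, Finset.sum_const,
      nsmul_eq_mul]
    rw [← Finset.mul_sum]
    have : ∑ u ∈ W, ∑ w ∈ W, (if u = w then G u else 0) = ∑ u ∈ W, G u :=
      Finset.sum_congr rfl fun u hu => by rw [Finset.sum_ite_eq, if_pos hu]
    rw [this]
    ring
  rw [e1]
  have hsum : 0 ≤ ∑ u ∈ W, G u := Finset.sum_nonneg fun u _ => hG0 u
  have h2 := mul_le_mul_of_nonneg_right (mul_le_mul_of_nonneg_right (card_window_le τ t)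
    (Real.sqrt_nonneg (sparsity f))) hsum
  linarith

/-- The distance of the virtual iterates to the minimizer contracts up to the delay terms. Strong
convexity holds at the point that is read; the quadratic gain is moved to the virtual iterate by
`‖x_t - x*‖² ≤ 2 ‖x̂_t - x*‖² + 2 ‖x̂_t - x_t‖²`. -/
theorem integral_norm_virtual_succ_sub_sq_le {τ : ℕ} (hn : 0 < n) (hΔ : 0 < sparsity f)
    (hγ : 0 ≤ γ) {μ : ℝ} (hμ : 0 ≤ μ) (hdiff : ∀ j, Differentiable ℝ (f j))
    (hcont : ∀ j, Continuous (gradient (f j)))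
    (hstrong : StrongConvexOn Set.univ μ (objective f)) (xstar : Vec d)
    (hα0 : ∀ j, ∀ v ∉ support (f j), α0 j v = 0)
    (hS : ∀ ω, (S ω).BoundedOverlap τ) (hi : FreshSampling P i X̂) (t : ℕ) :
    ∫ ω, ‖𝐱 (t + 1) ω - xstar‖ ^ 2 ∂P
      ≤ (1 - γ * μ / 2) * ∫ ω, ‖𝐱 t ω - xstar‖ ^ 2 ∂P
        + γ ^ 2 * ((1 + τ * √(sparsity f)) * ∫ ω, ‖𝐠 t ω‖ ^ 2 ∂P
          + (√(sparsity f) + γ * μ * (1 + τ * √(sparsity f)))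
            * ∑ u ∈ Finset.Ico (t - τ) t, ∫ ω, ‖𝐠 u ω‖ ^ 2 ∂P)
        - 2 * γ * ∫ ω, (objective f (X̂ t ω).1 - objective f xstar) ∂P := by
  have hR : BddMeas mΩ fun ω => (X̂ t ω).1 :=
    ((bddMeas_read hcont le_rfl).mono (hi.past_le t)).comp continuous_fst
  have hV : BddMeas mΩ (𝐱 t) := (bddMeas_virtual hcont t).mono (hi.past_le t)
  have hg : BddMeas mΩ (𝐠 t) := (bddMeas_update hcont (Nat.lt_succ_self t)).mono (hi.past_le _)
  have hsq : ∀ {Y : Ω → Vec d}, BddMeas mΩ Y → Integrable (fun ω => ‖Y ω‖ ^ 2) P := fun hY =>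
    (hY.comp (g := fun z => ‖z‖ ^ 2) (by fun_prop)).integrable
  have hin : ∀ {Y Z : Ω → Vec d}, BddMeas mΩ Y → BddMeas mΩ Z →
      Integrable (fun ω => inner ℝ (Y ω) (Z ω)) P := fun hY hZ =>
    ((hY.prodMk hZ).comp (g := fun p => inner ℝ p.1 p.2) (by fun_prop)).integrable
  have i1 := hsq (hV.sub (BddMeas.const xstar))
  have i2 := hin (hR.sub (BddMeas.const xstar)) hg
  have i3 := hin (hR.sub hV) hg
  have i4 := hsq hg
  have i5 := hsq (hR.sub hV)
  have hgradc : Continuous (gradient (objective f)) := by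
    rw [funext (gradient_objective hdiff)]
    fun_prop
  have i6 := hin (hR.sub (BddMeas.const xstar)) (hR.comp hgradc)
  have i7 : Integrable (fun ω => objective f (X̂ t ω).1 - objective f xstar) P :=
    (hR.comp (g := fun x => objective f x - objective f xstar)
      ((differentiable_objective hdiff).continuous.sub continuous_const)).integrable
  have hexp : ∫ ω, ‖𝐱 (t + 1) ω - xstar‖ ^ 2 ∂P = ∫ ω, ‖𝐱 t ω - xstar‖ ^ 2 ∂P
      - 2 * γ * ∫ ω, inner ℝ ((X̂ t ω).1 - xstar) (𝐠 t ω) ∂P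
      + 2 * γ * ∫ ω, inner ℝ ((X̂ t ω).1 - 𝐱 t ω) (𝐠 t ω) ∂P
      + γ ^ 2 * ∫ ω, ‖𝐠 t ω‖ ^ 2 ∂P := by
    have j1 : Integrable (fun ω => ‖𝐱 t ω - xstar‖ ^ 2
        - 2 * γ * inner ℝ ((X̂ t ω).1 - xstar) (𝐠 t ω)) P := i1.sub (i2.const_mul _)
    have j2 : Integrable (fun ω => ‖𝐱 t ω - xstar‖ ^ 2
        - 2 * γ * inner ℝ ((X̂ t ω).1 - xstar) (𝐠 t ω)
        + 2 * γ * inner ℝ ((X̂ t ω).1 - 𝐱 t ω) (𝐠 t ω)) P := j1.add (i3.const_mul _)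
    rw [← integral_const_mul, ← integral_const_mul, ← integral_const_mul,
      ← integral_sub i1 (i2.const_mul _), ← integral_add j1 (i3.const_mul _),
      ← integral_add j2 (i4.const_mul _)]
    refine integral_congr_ae (Filter.Eventually.of_forall fun ω => ?_)
    have e : 𝐱 (t + 1) ω - xstar = (𝐱 t ω - xstar) - γ • 𝐠 t ω := by
      have := virtualIterate_succ (f := f) (γ := γ) (x0 := x0) (α0 := α0)
        (i := fun s => i s ω) (S := S ω) t
      simp only [virtualProc, updateProc, this]
      abel
    have e2 : (X̂ t ω).1 - xstar = ((X̂ t ω).1 - 𝐱 t ω) + (𝐱 t ω - xstar) := by abel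
    simp only
    rw [e, norm_sub_sq_real, inner_smul_right, norm_smul, e2, inner_add_left, mul_pow,
      Real.norm_eq_abs, sq_abs]
    ring
  have hprog : ∫ ω, (objective f (X̂ t ω).1 - objective f xstar) ∂P
      + μ / 4 * ∫ ω, ‖𝐱 t ω - xstar‖ ^ 2 ∂P - μ / 2 * ∫ ω, ‖(X̂ t ω).1 - 𝐱 t ω‖ ^ 2 ∂P
      ≤ ∫ ω, inner ℝ ((X̂ t ω).1 - xstar) (gradient (objective f) (X̂ t ω).1) ∂P := by
    have j1 : Integrable (fun ω => objective f (X̂ t ω).1 - objective f xstar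
        + μ / 4 * ‖𝐱 t ω - xstar‖ ^ 2) P := i7.add (i1.const_mul _)
    rw [← integral_const_mul, ← integral_const_mul, ← integral_add i7 (i1.const_mul _),
      ← integral_sub j1 (i5.const_mul _)]
    refine integral_mono (j1.sub (i5.const_mul _)) i6 fun ω => ?_
    have h1 := hstrong.gradient_le (differentiable_objective hdiff) (X̂ t ω).1 xstar
    have e : xstar - (X̂ t ω).1 = -((X̂ t ω).1 - xstar) := by abel
    rw [e, inner_neg_right, norm_neg, real_inner_comm] at h1
    have e2 : 𝐱 t ω - xstar = ((X̂ t ω).1 - xstar) - ((X̂ t ω).1 - 𝐱 t ω) := by abel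
    have h2 : ‖𝐱 t ω - xstar‖ ^ 2 ≤ 2 * ‖(X̂ t ω).1 - xstar‖ ^ 2
        + 2 * ‖(X̂ t ω).1 - 𝐱 t ω‖ ^ 2 := by
      rw [e2]
      have := parallelogram_law_with_norm ℝ ((X̂ t ω).1 - xstar) ((X̂ t ω).1 - 𝐱 t ω)
      nlinarith [sq_nonneg ‖((X̂ t ω).1 - xstar) + ((X̂ t ω).1 - 𝐱 t ω)‖]
    have h3 := mul_le_mul_of_nonneg_left h2 hμ
    linarith
  rw [integral_inner_update hn hdiff hcont hα0 hi xstar t] at hexp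
  have h1 := mul_le_mul_of_nonneg_left hprog hγ
  have h2 := mul_le_mul_of_nonneg_left
    (integral_inner_displacement_le hn hΔ hγ hcont hα0 hS hi t) hγ
  have h3 := mul_le_mul_of_nonneg_left
    (integral_norm_displacement_sq_le hn hΔ hγ hcont hα0 hS hi t) (mul_nonneg hγ hμ)
  rw [hexp]
  linarith

end Progress

/-! ### The convergence rate -/

theorem support_eq_empty_of_sparsity_eq_zero {n d : ℕ} (hn : 0 < n) {f : Fin n → Vec d → ℝ}
    (h : sparsity f = 0) (j : Fin n) : support (f j) = ∅ := by
  have hn' : (n : ℝ) ≠ 0 := by positivity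
  have h1 : maxDegree f = 0 := by
    unfold sparsity at h
    simpa [hn'] using h
  refine Set.eq_empty_iff_forall_notMem.2 fun v hv => ?_
  have h2 : degree f v = 0 := Nat.le_zero.1 (h1 ▸ Finset.le_sup (f := degree f) (Finset.mem_univ v))
  rw [degree, Set.ncard_eq_zero] at h2
  exact Set.eq_empty_iff_forall_notMem.1 h2 j hv

/-- Without any support the objective is constant. -/
theorem objective_eq_of_sparsity_eq_zero {n d : ℕ} (hn : 0 < n) {f : Fin n → Vec d → ℝ}
    (hconvex : ∀ j, ConvexOn ℝ Set.univ (f j)) (hdiff : ∀ j, Differentiable ℝ (f j))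
    (h : sparsity f = 0) (x y : Vec d) : objective f x = objective f y := by
  have hle : ∀ j x y, f j x ≤ f j y := fun j x y => by
    have h0 : gradient (f j) x = 0 := by
      ext v
      exact gradient_apply_eq_zero (by simp [support_eq_empty_of_sparsity_eq_zero hn h j]) x
    have := (strongConvexOn_zero.2 (hconvex j)).gradient_le (hdiff j) x y
    rw [h0, inner_zero_left] at this
    linarith
  unfold objective
  rw [Finset.sum_congr rfl fun j _ => le_antisymm (hle j x y) (hle j y x)]

end Asaga

theorem theorem2 {n d τ : ℕ} {Ω : Type*} [MeasurableSpace Ω] (P : Measure Ω)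
    [IsProbabilityMeasure P]
    -- the finite-sum problem
    (f : Fin n → Asaga.Vec d → ℝ) (L μ : ℝ) (hL : 0 < L) (hμ : 0 < μ)
    (hconvex : ∀ i, ConvexOn ℝ Set.univ (f i))
    (hdiff : ∀ i, Differentiable ℝ (f i))
    (hsmooth : ∀ i x y, ‖gradient (f i) x - gradient (f i) y‖ ≤ L * ‖x - y‖)
    (hstrong : StrongConvexOn Set.univ μ (Asaga.objective f))
    (xstar : Asaga.Vec d) (hxstar : ∀ x, Asaga.objective f xstar ≤ Asaga.objective f x)
    -- the initial memory
    (x0 : Asaga.Vec d) (α0 : Fin n → Asaga.Vec d)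
    (hα0 : ∀ i, ∀ v ∉ Asaga.support (f i), α0 i v = 0)
    -- the overlap bound and the step size `γ = a / L`
    (hτ : (τ : ℝ) < n / 10)
    (a : ℝ) (ha : 0 < a) (ha' : a ≤ Asaga.aStar (L / μ) (Asaga.sparsity f) τ)
    -- the random execution
    (S : Ω → Asaga.Schedule n d) (hS : ∀ ω, (S ω).BoundedOverlap τ)
    (i : ℕ → Ω → Fin n)
    (hi : Asaga.FreshSampling P i
      (fun t ω => Asaga.reads f (a / L) x0 α0 (fun s => i s ω) (S ω) t)) :
    ∀ t : ℕ,
      Integrable (fun ω => Asaga.objective f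
        (Asaga.reads f (a / L) x0 α0 (fun s => i s ω) (S ω) t).1) P ∧
      (∫ ω, Asaga.objective f
          (Asaga.reads f (a / L) x0 α0 (fun s => i s ω) (S ω) t).1 ∂P)
          - Asaga.objective f xstar
        ≤ (1 - Asaga.rate n (L / μ) a) ^ t * Asaga.initConst f L (a / L) x0 α0 xstar := by
  intro t
  have hn : 0 < n := by
    have h0 : (0 : ℝ) ≤ τ := Nat.cast_nonneg τ
    have : (0 : ℝ) < n := by linarith
    exact_mod_cast this
  have hγ : 0 < a / L := div_pos ha hL
  have hi' : Asaga.FreshSampling P i (Asaga.readProc f (a / L) x0 α0 i S) := hi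
  have hcont := fun j => Asaga.continuous_gradient_of_lipschitz (hsmooth j)
  have hint : ∀ t, Integrable (fun ω => Asaga.objective f
      (Asaga.readProc f (a / L) x0 α0 i S t ω).1) P := fun t =>
    (((Asaga.bddMeas_read hcont le_rfl).mono (hi'.past_le t)).comp
      (g := fun p => Asaga.objective f p.1)
      ((Asaga.differentiable_objective hdiff).continuous.comp continuous_fst)).integrable
  have hsub : ∀ t, ∫ ω, (Asaga.objective f (Asaga.readProc f (a / L) x0 α0 i S t ω).1
      - Asaga.objective f xstar) ∂P
      = (∫ ω, Asaga.objective f (Asaga.readProc f (a / L) x0 α0 i S t ω).1 ∂P)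
        - Asaga.objective f xstar := fun t => by
    rw [integral_sub (hint t) (integrable_const _)]
    simp
  refine ⟨hint t, ?_⟩
  change (∫ ω, Asaga.objective f (Asaga.readProc f (a / L) x0 α0 i S t ω).1 ∂P)
    - Asaga.objective f xstar ≤ _
  rw [← hsub]
  have hΔ0 : 0 ≤ Asaga.sparsity f := by
    unfold Asaga.sparsity
    positivity
  rcases hΔ0.eq_or_lt with hΔ | hΔ
  · have h0 : ∀ x, Asaga.objective f x - Asaga.objective f xstar = 0 := fun x =>
      sub_eq_zero.2 (Asaga.objective_eq_of_sparsity_eq_zero hn hconvex hdiff hΔ.symm x xstar)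
    simp_rw [h0, integral_zero]
    obtain ⟨hρ0, hρn, -⟩ := Asaga.rate_bounds hn (div_pos hL hμ) ha
    have hn1 : (1 : ℝ) ≤ n := by exact_mod_cast hn
    refine mul_nonneg (pow_nonneg (by nlinarith) t) ?_
    unfold Asaga.initConst
    positivity
  · have hmain := Asaga.suboptimality_le_of_recursion hn hτ hL hμ hΔ ha ha'
      (V := 1 / (n : ℝ) * ∑ j, ‖α0 j - gradient (f j) xstar‖ ^ 2) (by positivity)
      (fun t => integral_nonneg (μ := P) fun ω => sq_nonneg
        ‖Asaga.virtualProc f (a / L) x0 α0 i S t ω - xstar‖)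
      (fun t => integral_nonneg (μ := P) fun ω => sq_nonneg
        ‖Asaga.updateProc f (a / L) x0 α0 i S t ω‖)
      (fun t => integral_nonneg (μ := P) fun ω => sub_nonneg.2
        (hxstar (Asaga.readProc f (a / L) x0 α0 i S t ω).1))
      (Asaga.integral_norm_virtual_succ_sub_sq_le hn hΔ hγ.le hμ.le hdiff hcont hstrong xstar
        hα0 hS hi')
      (Asaga.integral_norm_update_sq_le hn hL hconvex hdiff hsmooth hxstar hα0 hS hi') t
    refine hmain.trans_eq ?_
    simp [Asaga.initConst, Asaga.virtualProc, Asaga.virtualIterate]
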